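/- **Setting.** Identify the one-qubit Pauli group modulo phases with $\bar P=\{0,1\}^2$ (addition mod 2) by $I=00$, $Z=01$, $X=10$, $Y=11$. Let $\mathcal W(\rho)=\sum_{x\in X}\lambda_x\,|x\rangle\langle x|\otimes\sum_{w\in\bar P}p_x(w)\,w\rho w^\dagger$ be a classical mixture of Pauli (CMP) channels, with $X$ finite and $\lambda$ and all $p_x$ probability distributions. Its classical counterpart $W=\mathcal W^{\#}$ has input alphabet $\bar P$, output alphabet $X\times\bar P$ and $W(x,u\mid v)=\lambda_x p_x(u+v)$. The two-qubit Clifford gate $L$ is a CNOT (second qubit control, first qubit target) followed by a Hadamard gate on each qubit; modulo phases it acts on Pauli operators by conjugation as $\Gamma((u_1,u_2),(v_1,v_2))=((u_2,u_1+v_1),(u_2+v_2,v_1))$. For a classical channel $V$ with input alphabet $\bar P$ write $V_\Gamma(y_1,y_2\mid u,v)=V(y_1\mid\Gamma(u,v)_1)\,V(y_2\mid\Gamma(u,v)_2)$, and let $V^0(y_1,y_2\mid u)=\frac14\sum_{v}V_\Gamma(y_1,y_2\mid u,v)$, $V^1(y_1,y_2,u\mid v)=\frac14V_\Gamma(y_1,y_2\mid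 u,v)$. Put $W^{i_1\cdots i_n}=(W^{i_1\cdots i_{n-1}})^{i_n}$. Let $Z_d(V)=\frac14\sum_{v\in\bar P}\sum_y\sqrt{V(y\mid v)V(y\mid v+d)}$ and $Z_1=Z_{01}$, $Z_2=Z_{10}$, $Z_3=Z_{11}$. For $\delta>0$, $V$ is $\delta$-noiseless if $Z_1,Z_2,Z_3<\delta$; $\delta$-half-noisy of type 1 if $Z_2,Z_3<\delta$ and $Z_1>1-\delta$; $\delta$-half-noisy of type 2 if $Z_1,Z_3<\delta$ and $Z_2>1-\delta$; $\delta$-noisy if $Z_1,Z_2>1-\delta$. **Code.** Let $G$ be the encoding circuit on $N=2^n$ qubits made of $n$ layers of gates $L$, with inputs indexed by $i=i_1\cdots i_n\in\{0,1\}^n$ so that input $i$ sees the virtual channel $W^{i_1\cdots i_n}$; positions are ordered as binary numbers. For a threshold $0<\delta<\frac12$ let $\mathcal A,\mathcal B,\mathcal C$ be the sets of $i$ for which $W^{i_1\cdots i_n}$ is $\delta$-noiseless, $\delta$-half-noisy of type 1, $\delta$-half-noisy of type 2. The inputs in $\mathcal A$ carry quantum information, those in $\mathcal B$ are frozen to $|+\rangle$,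 those in $\mathcal C$ are frozen to $|0\rangle$, and all others are halves of preshared EPR pairs. **Decoding.** The $N$ uses of $\mathcal W$ produce flags $x\in X^N$ and a Pauli error $E\in\bar P^N$ with probability $\prod_k\lambda_{x_k}p_{x_k}(E_k)$. Put $E'=G^\dagger EG$ (modulo phases). Measurements give the second bit of $E'_i$ for $i\in\mathcal B$, the first bit for $i\in\mathcal C$, and both bits for $i\notin\mathcal A\cup\mathcal B\cup\mathcal C$. A successive cancellation decoder estimates $E'$ from these bits and $x$, position by position in increasing order. It copies the known bits. It decides the unknown ones by maximum likelihood for the virtual channel at that position, given the flags, the observation $I\cdots I$ of $E=GE'G^\dagger$ through $W^N$, and the preceding decisions, the later positions being treated as uniformly random. For $i\in\mathcal A$ both bits are decided jointly. For $i\in\mathcal B\cup\mathcal C$ the unknown bit is decided either from the partial channel obtained by averaging over the known bit, or conditionally on the known bit (one of the two rules is fixed; the result holds for both). Ties are broken arbitrarily. The block error probability $P_e^B$ is the probability that the estimate differs from $E'$. **Proposition (speed of polarization).** For every CMP channel $\mathcal W$ there are thresholds $\delta_n\in(0,\frac12)$ with $\delta_n\to0$ such that 1. the fraction of $i\in\{0,1\}^n$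 for which $W^{i_1\cdots i_n}$ is $\delta_n$-noiseless, $\delta_n$-half-noisy of type 1 or 2, or $\delta_n$-noisy tends to $1$ as $n\to\infty$; and 2. for every choice of successive cancellation decoders for the codes of length $2^n$ with threshold $\delta_n$, and for every $0<\beta<\frac14$, $$P_e^B=O\!\left(2^n\,2^{-2^{\beta n}}\right)\qquad(n\to\infty).$$ -/

import Mathlib

open scoped Topology Kronecker

universe u

namespace QPolar

noncomputable section

/-! ### Pauli operators, the gate `L`, and CMP channels -/

/-- The one-qubit Pauli group modulo phases, written additively as pairs of bits:
`I = 00`, `Z = 01`, `X = 10`, `Y = 11`. -/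
abbrev Pauli : Type := ZMod 2 × ZMod 2

/-- The operator `X ^ a * Z ^ b`, a representative of the class `(a, b)`. -/
def pauliMatrix (w : Pauli) : Matrix (Fin 2) (Fin 2) ℂ :=
  !![0, 1; 1, 0] ^ w.1.val * !![1, 0; 0, -1] ^ w.2.val

/-- The data of a classical mixture of Pauli channels: flag `x` occurs with probability
`weight x`, and then the Pauli error `w` occurs with probability `err x w`. -/
structure CMPChannel (X : Type u) [Fintype X] where
  weight : X → ℝ
  weight_nonneg : ∀ x, 0 ≤ weight x
  weight_sum : ∑ x, weight x = 1
  err : X → Pauli → ℝ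
  err_nonneg : ∀ x w, 0 ≤ err x w
  err_sum : ∀ x, ∑ w, err x w = 1

/-- The quantum channel `ρ ↦ ∑ x, weight x • |x⟩⟨x| ⊗ (∑ w, err x w • w ρ w†)`. -/
def CMPChannel.toLinearMap {X : Type u} [Fintype X] [DecidableEq X] (N : CMPChannel X) :
    Matrix (Fin 2) (Fin 2) ℂ →ₗ[ℂ] Matrix (X × Fin 2) (X × Fin 2) ℂ where
  toFun ρ := ∑ x, (N.weight x : ℂ) • (Matrix.single x x (1 : ℂ) ⊗ₖ
    ∑ w, (N.err x w : ℂ) • (pauliMatrix w * ρ * (pauliMatrix w).conjTranspose))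
  map_add' ρ σ := by
    simp only [mul_add, add_mul, smul_add, Finset.sum_add_distrib, Matrix.kronecker_add]
  map_smul' c ρ := by
    simp only [Matrix.mul_smul, Matrix.smul_mul, RingHom.id_apply, Finset.smul_sum]
    refine Finset.sum_congr rfl fun x _ => ?_
    simp only [smul_comm _ c]
    rw [← Finset.smul_sum, Matrix.kronecker_smul, smul_comm]

/-- The Hadamard gate. -/
def hadamard : Matrix (Fin 2) (Fin 2) ℂ :=
  ((Real.sqrt 2 : ℂ)⁻¹) • !![1, 1; 1, -1]

/-- The controlled-not gate with the second qubit as control and the first as target. -/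
def cnotRev : Matrix (Fin 2 × Fin 2) (Fin 2 × Fin 2) ℂ :=
  fun a b => if a = (b.1 + b.2, b.2) then 1 else 0

/-- The two-qubit Clifford gate `L`: a controlled-not, then a Hadamard gate on both qubits. -/
def gateL : Matrix (Fin 2 × Fin 2) (Fin 2 × Fin 2) ℂ :=
  (hadamard ⊗ₖ hadamard) * cnotRev

/-- The permutation `Γ(L)` of pairs of Pauli classes. -/
def gammaL (w : Pauli × Pauli) : Pauli × Pauli :=
  ((w.1.2, w.1.1 + w.2.1), (w.1.2 + w.2.2, w.2.1))

theorem hadamard_conj (w : Pauli) :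
    hadamard * pauliMatrix w * hadamard.conjTranspose =
      (-1 : ℂ) ^ (w.1.val * w.2.val) • pauliMatrix (w.2, w.1) := by
  have h2 : ((Real.sqrt 2 : ℝ) : ℂ)⁻¹ * ((Real.sqrt 2 : ℝ) : ℂ)⁻¹ = 1 / 2 := by
    rw [← mul_inv, ← Complex.ofReal_mul, Real.mul_self_sqrt (by norm_num)]; norm_num
  have hs : (starRingEnd ℂ) ((Real.sqrt 2 : ℝ) : ℂ) = ((Real.sqrt 2 : ℝ) : ℂ) :=
    Complex.conj_ofReal _
  have hH : hadamard.conjTranspose = hadamard := by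
    ext i j
    fin_cases i <;> fin_cases j <;> simp [hadamard, Matrix.conjTranspose_apply]
  rw [hH]
  simp only [hadamard, Matrix.smul_mul, Matrix.mul_smul, smul_smul, h2]
  obtain ⟨a, b⟩ := w
  fin_cases a <;> fin_cases b <;> ext i j <;> fin_cases i <;> fin_cases j <;>
    simp [pauliMatrix, ZMod.val] <;> norm_num

theorem cnotRev_conj (w : Pauli × Pauli) :
    cnotRev * (pauliMatrix w.1 ⊗ₖ pauliMatrix w.2) * cnotRev.conjTranspose =
      pauliMatrix (w.1.1 + w.2.1, w.1.2) ⊗ₖ pauliMatrix (w.2.1, w.1.2 + w.2.2) := by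
  have hP : ∀ (v : Pauli) (i j : Fin 2), pauliMatrix v i j =
      ((if i.val = (j.val + v.1.val) % 2 then (-1) ^ (v.2.val * j.val) else 0 : ℤ) : ℂ) := by
    rintro ⟨a, b⟩ i j
    fin_cases a <;> fin_cases b <;> fin_cases i <;> fin_cases j <;> simp [pauliMatrix, ZMod.val]
  have hσ : ∀ M : Matrix (Fin 2 × Fin 2) (Fin 2 × Fin 2) ℂ, ∀ i j,
      (cnotRev * M * cnotRev.conjTranspose) i j = M (i.1 + i.2, i.2) (j.1 + j.2, j.2) := by
    have h : ∀ i k : Fin 2 × Fin 2, i = (k.1 + k.2, k.2) ↔ k = (i.1 + i.2, i.2) := by decide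
    intro M i j
    simp [Matrix.mul_apply, cnotRev, Matrix.conjTranspose_apply, h, apply_ite]
  ext i j
  rw [hσ]
  simp only [Matrix.kroneckerMap_apply, hP, ← Int.cast_mul]
  congr 1
  revert w i j
  decide +kernel

/-- `gammaL` is the conjugation action of `gateL` on Pauli classes. -/
theorem gateL_conj (w : Pauli × Pauli) : ∃ c : ℂ, ‖c‖ = 1 ∧
    gateL * (pauliMatrix w.1 ⊗ₖ pauliMatrix w.2) * gateL.conjTranspose =
      c • (pauliMatrix (gammaL w).1 ⊗ₖ pauliMatrix (gammaL w).2) := by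
  refine ⟨(-1 : ℂ) ^ ((w.1.1 + w.2.1).val * w.1.2.val) *
    (-1 : ℂ) ^ (w.2.1.val * (w.1.2 + w.2.2).val), by simp, ?_⟩
  have h : gateL * (pauliMatrix w.1 ⊗ₖ pauliMatrix w.2) * gateL.conjTranspose =
      (hadamard ⊗ₖ hadamard) * (cnotRev * (pauliMatrix w.1 ⊗ₖ pauliMatrix w.2) *
        cnotRev.conjTranspose) * (hadamard.conjTranspose ⊗ₖ hadamard.conjTranspose) := by
    simp only [gateL, Matrix.conjTranspose_mul, Matrix.conjTranspose_kronecker, Matrix.mul_assoc]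
  rw [h, cnotRev_conj, ← Matrix.mul_kronecker_mul, ← Matrix.mul_kronecker_mul, hadamard_conj,
    hadamard_conj, Matrix.smul_kronecker, Matrix.kronecker_smul, smul_smul]
  rfl

theorem gammaL_bijective : Function.Bijective gammaL := by
  decide

/-! ### Classical channels with input alphabet `Pauli` -/

/-- A classical channel with input alphabet `Pauli` and a finite output alphabet;
`prob y v` is the probability of the output `y` given the input `v`. -/
structure Chan where
  Out : Type u
  [fintypeOut : Fintype Out]
  prob : Out → Pauli → ℝ
  prob_nonneg : ∀ y v, 0 ≤ prob y v
  prob_sum : ∀ v, ∑ y, prob y v = 1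

attribute [instance] Chan.fintypeOut

/-- The classical counterpart of a CMP channel. -/
abbrev CMPChannel.counterpart {X : Type u} [Fintype X] (N : CMPChannel X) : Chan.{u} where
  Out := X × Pauli
  prob y v := N.weight y.1 * N.err y.1 (y.2 + v)
  prob_nonneg y v := mul_nonneg (N.weight_nonneg _) (N.err_nonneg _ _)
  prob_sum v := by
    rw [Fintype.sum_prod_type]
    simp only [← Finset.mul_sum]
    have h : ∀ x, ∑ w : Pauli, N.err x (w + v) = 1 := fun x => by
      rw [← N.err_sum x]
      exact Equiv.sum_comp (Equiv.addRight v) (N.err x)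
    simp [h, N.weight_sum]

namespace Chan

/-- Two copies of `W` combined through `Γ(L)`. -/
def combine (W : Chan.{u}) (y₁ y₂ : W.Out) (a v : Pauli) : ℝ :=
  W.prob y₁ (gammaL (a, v)).1 * W.prob y₂ (gammaL (a, v)).2

theorem combine_nonneg (W : Chan.{u}) (y₁ y₂ : W.Out) (a v : Pauli) :
    0 ≤ W.combine y₁ y₂ a v :=
  mul_nonneg (W.prob_nonneg _ _) (W.prob_nonneg _ _)

theorem combine_sum (W : Chan.{u}) (a v : Pauli) :
    ∑ y : W.Out × W.Out, W.combine y.1 y.2 a v = 1 := by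
  simp only [combine, Fintype.sum_prod_type, ← Finset.mul_sum, W.prob_sum, mul_one]

/-- The bad channel: the second input is uniformly random. -/
def bad (W : Chan.{u}) : Chan.{u} where
  Out := W.Out × W.Out
  prob y a := ∑ v : Pauli, 1 / 4 * W.combine y.1 y.2 a v
  prob_nonneg y a := Finset.sum_nonneg fun v _ =>
    mul_nonneg (by norm_num) (W.combine_nonneg _ _ _ _)
  prob_sum a := by
    rw [Finset.sum_comm]
    simp only [← Finset.mul_sum, W.combine_sum]
    simp

/-- The good channel: the first input is uniformly random and given to the receiver. -/
def good (W : Chan.{u}) : Chan.{u} where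
  Out := Pauli × (W.Out × W.Out)
  prob y v := 1 / 4 * W.combine y.2.1 y.2.2 y.1 v
  prob_nonneg y v := mul_nonneg (by norm_num) (W.combine_nonneg _ _ _ _)
  prob_sum v := by
    rw [Fintype.sum_prod_type]
    simp only [← Finset.mul_sum, W.combine_sum]
    simp

/-- One polarization step: `false` (bit `0`) is the bad, `true` (bit `1`) the good channel. -/
def step (W : Chan.{u}) (b : Bool) : Chan.{u} := if b then W.good else W.bad

/-- The virtual channel `W^{i₁ ⋯ iₙ} = (⋯ (W^{i₁})^{i₂} ⋯)^{iₙ}`. -/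
def virt (W : Chan.{u}) {n : ℕ} (i : Fin n → Bool) : Chan.{u} :=
  (List.ofFn i).foldl step W

/-- `Z(W_{v,v'})`. -/
def bhatPair (W : Chan.{u}) (v v' : Pauli) : ℝ :=
  ∑ y, Real.sqrt (W.prob y v * W.prob y v')

/-- The Bhattacharyya parameter `Z_d(W)`. -/
def bhat (W : Chan.{u}) (d : Pauli) : ℝ :=
  1 / 4 * ∑ v : Pauli, W.bhatPair v (v + d)

/-- `Z_1, Z_2, Z_3` correspond to `d = 01, 10, 11`. -/
def IsNoiseless (W : Chan.{u}) (δ : ℝ) : Prop :=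
  W.bhat (0, 1) < δ ∧ W.bhat (1, 0) < δ ∧ W.bhat (1, 1) < δ

def IsNoisy (W : Chan.{u}) (δ : ℝ) : Prop :=
  1 - δ < W.bhat (0, 1) ∧ 1 - δ < W.bhat (1, 0)

/-- Half-noisy of type 1. -/
def IsHalfNoisyOne (W : Chan.{u}) (δ : ℝ) : Prop :=
  W.bhat (1, 0) < δ ∧ W.bhat (1, 1) < δ ∧ 1 - δ < W.bhat (0, 1)

/-- Half-noisy of type 2. -/
def IsHalfNoisyTwo (W : Chan.{u}) (δ : ℝ) : Prop :=
  W.bhat (0, 1) < δ ∧ W.bhat (1, 1) < δ ∧ 1 - δ < W.bhat (1, 0)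

end Chan

/-! ### The polar code -/

/-- The action on Pauli errors (modulo phases) of the encoding circuit made of `n` layers of
gates `L`. The inputs are indexed by `i₁ ⋯ iₙ`. The inputs with `i₁ = 0`, respectively
`i₁ = 1`, enter two copies of the circuit with `n - 1` layers; the `j`-th outputs of the two
copies are the first, respectively second, input of a gate `L`, whose outputs go to the
channel uses `0j` and `1j`. -/
def polarTransform : (n : ℕ) → ((Fin n → Bool) → Pauli) → ((Fin n → Bool) → Pauli)
  | 0, e => e
  | n + 1, e => fun j =>
      let w := gammaL (polarTransform n (fun t => e (Fin.cons false t)) (Fin.tail j),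
        polarTransform n (fun t => e (Fin.cons true t)) (Fin.tail j))
      if j 0 then w.2 else w.1

theorem polarTransform_bijective (n : ℕ) : Function.Bijective (polarTransform n) := by
  rw [← Finite.injective_iff_bijective]
  induction n with
  | zero => exact fun _ _ h => h
  | succ n ih =>
    intro e e' h
    have key : ∀ t : Fin n → Bool,
        (polarTransform n (fun t => e (Fin.cons false t)) t,
          polarTransform n (fun t => e (Fin.cons true t)) t) =
        (polarTransform n (fun t => e' (Fin.cons false t)) t,
          polarTransform n (fun t => e' (Fin.cons true t)) t) := by
      intro t
      apply gammaL_bijective.1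
      have h0 := congrFun h (Fin.cons false t)
      have h1 := congrFun h (Fin.cons true t)
      simp only [polarTransform, Fin.cons_zero, Fin.tail_cons, if_true, Bool.false_eq_true,
        if_false] at h0 h1
      exact Prod.ext h0 h1
    have hf := ih (funext fun t => congrArg Prod.fst (key t))
    have ht := ih (funext fun t => congrArg Prod.snd (key t))
    funext i
    rw [← Fin.cons_self_tail i]
    cases i 0
    · exact congrFun hf _
    · exact congrFun ht _

/-- `polarTransform` as a permutation; its inverse takes an error `E` on the channel uses to
the error `E' = G† E G` at the inputs of the encoding circuit `G`. -/
def polarPerm (n : ℕ) : ((Fin n → Bool) → Pauli) ≃ ((Fin n → Bool) → Pauli) :=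
  Equiv.ofBijective _ (polarTransform_bijective n)

/-- How the input of a virtual channel is used: to send quantum information (`info`), frozen
to `|+⟩` (`plus`, the decoder measures the second bit of `E'_i`), frozen to `|0⟩` (`zero`, the
decoder measures the first bit of `E'_i`), or set to half of a preshared EPR pair (`epr`, the
decoder measures both bits of `E'_i`). -/
inductive Role
  | info
  | plus
  | zero
  | epr

/-- What the measurements reveal about the error `w` (bits not revealed are replaced by `0`). -/
def Role.reveal : Role → Pauli → Pauli
  | .info, _ => 0
  | .plus, w => (0, w.2)
  | .zero, w => (w.1, 0)
  | .epr, w => w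

section Code

variable {X : Type u} [Fintype X] (N : CMPChannel X) (δ : ℝ) (n : ℕ)

open Classical in
/-- The role of position `i` in the code of length `2 ^ n` with threshold `δ`. -/
def role (i : Fin n → Bool) : Role :=
  if (N.counterpart.virt i).IsNoiseless δ then .info
  else if (N.counterpart.virt i).IsHalfNoisyOne δ then .plus
  else if (N.counterpart.virt i).IsHalfNoisyTwo δ then .zero
  else .epr

/-- The measurement outcomes when the error at the circuit inputs is `e`. -/
def syndrome (e : (Fin n → Bool) → Pauli) : (Fin n → Bool) → Pauli :=
  fun i => (role N δ n i).reveal (e i)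

open Classical in
/-- The likelihood of `v` at position `i`, given the flags `x`, the observation `I ⋯ I`, and
the values `a j` at the positions `j` that precede `i`, with the later positions uniformly
random (up to the constant normalization of the virtual channel): the sum, over all `e` that
agree with `a` before `i` and with `v` at `i`, of the probability that the copies of the
classical counterpart channel output `(x, I ⋯ I)` on input `polarTransform n e`. Positions are
ordered as binary numbers `i₁ ⋯ iₙ`, that is, lexicographically. -/
def likelihood (x : (Fin n → Bool) → X) (a : (Fin n → Bool) → Pauli)
    (i : Fin n → Bool) (v : Pauli) : ℝ :=
  ∑ e : (Fin n → Bool) → Pauli,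
    if (∀ j, toLex j < toLex i → e j = a j) ∧ e i = v then
      ∏ k, N.counterpart.prob (x k, 0) (polarTransform n e k)
    else 0

/-- How the unknown bit of a half-noisy position is decided: through the partial channel, which
averages over the known bit, or conditionally on the known bit. -/
inductive HalfRule
  | partialChannel
  | conditional

/-- The likelihood of `b` for the first bit, when the second bit is known to be `k`. -/
def HalfRule.first (r : HalfRule) (l : Pauli → ℝ) (k b : ZMod 2) : ℝ :=
  match r with
  | .partialChannel => l (b, 0) + l (b, 1)
  | .conditional => l (b, k)

/-- The likelihood of `b` for the second bit, when the first bit is known to be `k`. -/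
def HalfRule.second (r : HalfRule) (l : Pauli → ℝ) (k b : ZMod 2) : ℝ :=
  match r with
  | .partialChannel => l (0, b) + l (1, b)
  | .conditional => l (k, b)

/-- The successive cancellation rule at a position with role `c`, measurement outcome `s` and
likelihood function `l`, for the decision `w`: known bits are copied, unknown ones are decided
by maximum likelihood (ties may be broken in any way). -/
def Decides (r : HalfRule) (l : Pauli → ℝ) (s : Pauli) (w : Pauli) : Role → Prop
  | .info => ∀ v, l v ≤ l w
  | .plus => w.2 = s.2 ∧ ∀ b, r.first l s.2 b ≤ r.first l s.2 w.1
  | .zero => w.1 = s.1 ∧ ∀ b, r.second l s.1 b ≤ r.second l s.1 w.2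
  | .epr => w = s

/-- `dec x s` is the estimate of the error at the circuit inputs from the flags `x` and the
measurement outcomes `s`. Each position is decided from the decisions at the preceding
positions. -/
def IsSCDecoder (r : HalfRule)
    (dec : ((Fin n → Bool) → X) → ((Fin n → Bool) → Pauli) → ((Fin n → Bool) → Pauli)) : Prop :=
  ∀ x s i, Decides r (likelihood N n x (dec x s) i) (s i) (dec x s i) (role N δ n i)

/-- Successive cancellation decoders exist. -/
theorem exists_isSCDecoder (r : HalfRule) : ∃ dec, IsSCDecoder N δ n r dec := by
  have hex : ∀ (l : Pauli → ℝ) (s : Pauli) (c : Role), ∃ w, Decides r l s w c := by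
    intro l s c
    cases c with
    | info => exact Finite.exists_max l
    | plus =>
      obtain ⟨b, hb⟩ := Finite.exists_max (r.first l s.2)
      exact ⟨(b, s.2), rfl, hb⟩
    | zero =>
      obtain ⟨b, hb⟩ := Finite.exists_max (r.second l s.1)
      exact ⟨(s.1, b), rfl, hb⟩
    | epr => exact ⟨s, rfl⟩
  choose f hf using hex
  have hlik : ∀ x i (a a' : (Fin n → Bool) → Pauli), (∀ j, toLex j < toLex i → a j = a' j) →
      likelihood N n x a i = likelihood N n x a' i := by
    intro x i a a' h
    funext v
    unfold likelihood
    refine Finset.sum_congr rfl fun e _ => ?_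
    have : (∀ j, toLex j < toLex i → e j = a j) ↔ (∀ j, toLex j < toLex i → e j = a' j) :=
      forall_congr' fun j => imp_congr_right fun hj => by rw [h j hj]
    have h' := and_congr_left' (c := e i = v) this
    by_cases hc : (∀ j, toLex j < toLex i → e j = a j) ∧ e i = v
    · rw [if_pos hc, if_pos (h'.1 hc)]
    · rw [if_neg hc, if_neg fun hc' => hc (h'.2 hc')]
  have hwf : WellFounded (fun j i : Fin n → Bool => toLex j < toLex i) :=
    InvImage.wf toLex wellFounded_lt
  classical
  refine ⟨fun x s => hwf.fix fun i rec =>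
    f (likelihood N n x (fun j => if h : toLex j < toLex i then rec j h else 0) i) (s i)
      (role N δ n i), fun x s i => ?_⟩
  beta_reduce
  generalize hF : (hwf.fix fun i rec =>
    f (likelihood N n x (fun j => if h : toLex j < toLex i then rec j h else 0) i) (s i)
      (role N δ n i)) = F
  have hi : F i = f (likelihood N n x F i) (s i) (role N δ n i) := by
    rw [← hF, WellFounded.fix_eq]
    congr 1
    apply hlik
    intro j hj
    simp [hj]
  rw [hi]
  exact hf _ _ _

open Classical in
/-- The block error probability: the channel uses produce the flags `x` and the Pauli errors
`E` (the output of the classical counterpart on input `I ⋯ I`), and the decoder fails to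
recover the error at the circuit inputs. -/
def blockErrorProb
    (dec : ((Fin n → Bool) → X) → ((Fin n → Bool) → Pauli) → ((Fin n → Bool) → Pauli)) : ℝ :=
  ∑ x : (Fin n → Bool) → X, ∑ E : (Fin n → Bool) → Pauli,
    if dec x (syndrome N δ n ((polarPerm n).symm E)) ≠ (polarPerm n).symm E then
      ∏ k, N.counterpart.prob (x k, E k) 0
    else 0

/-- The set of positions whose virtual channel is noiseless, half-noisy of type 1 or 2, or
noisy, for the threshold `δ`. -/
def polarizedSet : Set (Fin n → Bool) :=
  {i | (N.counterpart.virt i).IsNoiseless δ ∨ (N.counterpart.virt i).IsHalfNoisyOne δ ∨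
    (N.counterpart.virt i).IsHalfNoisyTwo δ ∨ (N.counterpart.virt i).IsNoisy δ}

end Code

end

end QPolar

/-!
The proof follows the two families of parameters of a virtual channel `V` that move in opposite
directions: the Bhattacharyya parameters `Z_1, Z_2, Z_3`, and the averaged total variation
distances `T_1, T_2, T_3` between the outputs of inputs that differ by `01`, `10`, `11`. They are
related by `1 - Z ≤ T` and `Z ^ 2 + T ^ 2 ≤ 1`, so that a small `T` means a `Z` close to `1`.

A good step maps `(Z_1, Z_2, Z_3)` to `(Z_2, Z_1 ^ 2, Z_1 Z_3)`. With `U_j = max(Z_j, Z_3)`, a bad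
step sends `(U_1, U_2)` below `(4 U_2, 4 U_1)`. Dually, a bad step sends `(T_1, T_2)` below
`(T_2, T_1 ^ 2)`, and a good step below `(T_2, 2 T_1 - T_1 ^ 2)`. Hence both `(U_1, U_2)` and
`(T_1, T_2)` follow the same pattern (`SquaredBy`): the indices alternate, and every second time
one of the two steps squares the parameter, while nothing grows by more than the factor `4`.

*Polarization.* The function `2 t - t ^ 2` is increasing and concave, so the average of
`∑ j, (2 T_j - T_j ^ 2)` over the virtual channels decreases, by at least the average of
`(T_1 (1 - T_1)) ^ 2`. Hence `T_1` and `T_2` tend to `{0, 1}` for almost all virtual channels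
(`tendsto_pathAvg_unpol`). When exactly one of them is close to `1`, then so is `T_3` by the
triangle inequality, and `Z_3` is small. When both are close to `1`, then `Z_3` is small because
the channel results from a step: after a bad step this follows from the identity
`T_2(V.bad) = T_1(V) * tvSnd V` with `tvSnd V ≤ T_3(V)`, and after a good step from
`Z_3(V.good) = Z_1(V) Z_3(V)`. So for each `j = 1, 2`, either `U_j` or `T_j` is small, which places
the channel in one of the four regimes: noiseless, half-noisy of type 1 or 2, or noisy.

*Speed.* If `2 ^ (-L)` bounds a parameter, then `L` is doubled with probability `1 / 2` in every
second step, and otherwise decreases by at most `2`. As long as `L` is large, the average of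
`L ^ (-s)` over two steps shrinks by a factor close to `(1 + 2 ^ (-s)) / 2`, which for small `s`
is below `2 ^ (-2 β s)` for any given `β < 1 / 4`. An induction on the number of steps
(`pathAvg_squaredBy_le`) gives `L ≥ 2 ^ (β n)` outside a vanishing fraction. This holds for small
`U_j` and for small `T_j`, so a single threshold of the order `2 ^ (-2 ^ (β n))` serves all four
regimes; the exponent `β` is then moved to `1 / 4` along a diagonal sequence.

*Decoding.* By the union bound over the first wrong decision, and since a maximum likelihood
error implies `l(v) ≤ ∑ d, √(l(v) l(v + d))` over the confusable `d`, the block error probability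
is at most the sum over the positions of the relevant Bhattacharyya parameters, each of which
is below the threshold. The recursion of the polar transform identifies the likelihoods with the
transition probabilities of the virtual channels (`sum_sqrtSum`), and the symmetry of the
classical counterpart allows restricting to the observation `I ⋯ I`.
-/

namespace QPolar

noncomputable section

/-! ### Distances between the rows of a channel -/

theorem gammaL_add (w w' : Pauli × Pauli) : gammaL (w + w') = gammaL w + gammaL w' := by
  obtain ⟨⟨a, b⟩, c, d⟩ := w
  obtain ⟨⟨a', b'⟩, c', d'⟩ := w'
  simp only [gammaL, Prod.mk_add_mk]
  ext <;> simp only <;> ring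

/-- If a pair is uniformly random, then so is its image under `gammaL`. -/
theorem sum_gammaL (F G : Pauli → ℝ) :
    ∑ w : Pauli × Pauli, F (gammaL w).1 * G (gammaL w).2 = (∑ p, F p) * ∑ q, G q := by
  rw [Finset.sum_mul_sum, ← Fintype.sum_prod_type' (f := fun p q => F p * G q)]
  exact Equiv.sum_comp (Equiv.ofBijective gammaL gammaL_bijective)
    (fun w : Pauli × Pauli => F w.1 * G w.2)

theorem sqrt_sum_le {ι : Type*} (s : Finset ι) (f : ι → ℝ) (hf : ∀ i, 0 ≤ f i) :
    Real.sqrt (∑ i ∈ s, f i) ≤ ∑ i ∈ s, Real.sqrt (f i) := by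
  classical
  induction s using Finset.induction_on with
  | empty => simp
  | insert a s ha ih =>
    rw [Finset.sum_insert ha, Finset.sum_insert ha]
    refine le_trans ?_ (add_le_add le_rfl ih)
    have h0 : 0 ≤ ∑ i ∈ s, f i := Finset.sum_nonneg fun i _ => hf i
    refine Real.sqrt_le_iff.2 ⟨by positivity, ?_⟩
    nlinarith [Real.sq_sqrt (hf a), Real.sq_sqrt h0, Real.sqrt_nonneg (f a),
      Real.sqrt_nonneg (∑ i ∈ s, f i),
      mul_nonneg (Real.sqrt_nonneg (f a)) (Real.sqrt_nonneg (∑ i ∈ s, f i))]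

namespace Chan

variable (W : Chan.{u})

theorem bhatPair_nonneg (v v' : Pauli) : 0 ≤ W.bhatPair v v' :=
  Finset.sum_nonneg fun _ _ => Real.sqrt_nonneg _

theorem bhat_nonneg (d : Pauli) : 0 ≤ W.bhat d :=
  mul_nonneg (by norm_num) (Finset.sum_nonneg fun _ _ => W.bhatPair_nonneg _ _)

theorem bhatPair_self (v : Pauli) : W.bhatPair v v = 1 := by
  unfold bhatPair
  rw [← W.prob_sum v]
  exact Finset.sum_congr rfl fun y _ => Real.sqrt_mul_self (W.prob_nonneg y v)

theorem bhat_zero : W.bhat (0, 0) = 1 := by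
  have : ((0, 0) : Pauli) = 0 := rfl
  simp [bhat, this, bhatPair_self]

/-- The total variation distance between the output distributions of two inputs. -/
def tvPair (v v' : Pauli) : ℝ := 1 / 2 * ∑ y, |W.prob y v - W.prob y v'|

/-- The total variation distance between inputs that differ by `d`, averaged over the inputs:
the counterpart of `bhat` that is small for noisy channels. -/
def tv (d : Pauli) : ℝ := 1 / 4 * ∑ v : Pauli, W.tvPair v (v + d)

theorem tvPair_nonneg (v v' : Pauli) : 0 ≤ W.tvPair v v' :=
  mul_nonneg (by norm_num) (Finset.sum_nonneg fun _ _ => abs_nonneg _)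

theorem tv_nonneg (d : Pauli) : 0 ≤ W.tv d :=
  mul_nonneg (by norm_num) (Finset.sum_nonneg fun _ _ => W.tvPair_nonneg _ _)

theorem tvPair_self (v : Pauli) : W.tvPair v v = 0 := by simp [tvPair]

theorem tvPair_comm (v v' : Pauli) : W.tvPair v v' = W.tvPair v' v := by
  simp only [tvPair, abs_sub_comm]

theorem tvPair_triangle (a b c : Pauli) : W.tvPair a c ≤ W.tvPair a b + W.tvPair b c := by
  unfold tvPair
  rw [← mul_add, ← Finset.sum_add_distrib]
  exact mul_le_mul_of_nonneg_left
    (Finset.sum_le_sum fun y _ => abs_sub_le _ _ _) (by norm_num)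

theorem one_sub_tvPair (v v' : Pauli) :
    1 - W.tvPair v v' = ∑ y, min (W.prob y v) (W.prob y v') := by
  have h : ∀ a b : ℝ, min a b = 1 / 2 * (a + b) - 1 / 2 * |a - b| := fun a b => by
    rcases le_total a b with h | h
    · rw [min_eq_left h, abs_of_nonpos (by linarith)]; ring
    · rw [min_eq_right h, abs_of_nonneg (by linarith)]; ring
  simp only [h, Finset.sum_sub_distrib, ← Finset.mul_sum, Finset.sum_add_distrib, W.prob_sum,
    tvPair]
  norm_num

theorem tvPair_le_one (v v' : Pauli) : W.tvPair v v' ≤ 1 := by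
  have : 0 ≤ 1 - W.tvPair v v' := by
    rw [one_sub_tvPair]
    exact Finset.sum_nonneg fun y _ => le_min (W.prob_nonneg _ _) (W.prob_nonneg _ _)
  linarith

theorem tv_le_one (d : Pauli) : W.tv d ≤ 1 := by
  have : ∑ v : Pauli, W.tvPair v (v + d) ≤ ∑ v : Pauli, (1 : ℝ) :=
    Finset.sum_le_sum fun v _ => W.tvPair_le_one _ _
  simp at this
  unfold tv
  linarith

theorem one_sub_bhatPair_le_tvPair (v v' : Pauli) : 1 - W.bhatPair v v' ≤ W.tvPair v v' := by
  rw [sub_le_comm, one_sub_tvPair]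
  refine Finset.sum_le_sum fun y _ => Real.le_sqrt_of_sq_le ?_
  rw [sq]
  exact mul_le_mul (min_le_left _ _) (min_le_right _ _)
    (le_min (W.prob_nonneg _ _) (W.prob_nonneg _ _)) (W.prob_nonneg _ _)

theorem one_sub_bhat_le_tv (d : Pauli) : 1 - W.bhat d ≤ W.tv d := by
  have := Finset.sum_le_sum fun (v : Pauli) (_ : v ∈ Finset.univ) =>
    W.one_sub_bhatPair_le_tvPair v (v + d)
  simp only [Finset.sum_sub_distrib] at this
  simp at this
  unfold tv bhat
  linarith

/-- Cauchy–Schwarz applied to `|a - b| = |√a - √b| (√a + √b)`. -/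
theorem bhatPair_sq_add_tvPair_sq_le (v v' : Pauli) :
    W.bhatPair v v' ^ 2 + W.tvPair v v' ^ 2 ≤ 1 := by
  have hs : ∀ y w, Real.sqrt (W.prob y w) ^ 2 = W.prob y w := fun y w =>
    Real.sq_sqrt (W.prob_nonneg y w)
  have hz : W.bhatPair v v' = ∑ y, Real.sqrt (W.prob y v) * Real.sqrt (W.prob y v') :=
    Finset.sum_congr rfl fun y _ => Real.sqrt_mul (W.prob_nonneg _ _) _
  have h1 : ∑ y, |Real.sqrt (W.prob y v) - Real.sqrt (W.prob y v')| ^ 2 =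
      2 - 2 * W.bhatPair v v' := by
    rw [hz, Finset.mul_sum]
    simp only [sq_abs, sub_sq, hs, Finset.sum_add_distrib, Finset.sum_sub_distrib, W.prob_sum,
      mul_assoc]
    ring
  have h2 : ∑ y, (Real.sqrt (W.prob y v) + Real.sqrt (W.prob y v')) ^ 2 =
      2 + 2 * W.bhatPair v v' := by
    rw [hz, Finset.mul_sum]
    simp only [add_sq, hs, Finset.sum_add_distrib, W.prob_sum, mul_assoc]
    ring
  have h3 : ∑ y, |W.prob y v - W.prob y v'| =
      ∑ y, |Real.sqrt (W.prob y v) - Real.sqrt (W.prob y v')| *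
        (Real.sqrt (W.prob y v) + Real.sqrt (W.prob y v')) := by
    refine Finset.sum_congr rfl fun y _ => ?_
    rw [← abs_of_nonneg (add_nonneg (Real.sqrt_nonneg (W.prob y v))
      (Real.sqrt_nonneg (W.prob y v'))), ← abs_mul, ← hs y v, ← hs y v']
    simp only [Real.sqrt_sq (Real.sqrt_nonneg _)]
    ring_nf
  have h4 := Finset.sum_mul_sq_le_sq_mul_sq Finset.univ
    (fun y => |Real.sqrt (W.prob y v) - Real.sqrt (W.prob y v')|)
    (fun y => Real.sqrt (W.prob y v) + Real.sqrt (W.prob y v'))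
  rw [h1, h2, ← h3] at h4
  unfold tvPair
  linarith

theorem bhat_sq_add_tv_sq_le (d : Pauli) : W.bhat d ^ 2 + W.tv d ^ 2 ≤ 1 := by
  have h1 := sq_sum_le_card_mul_sum_sq (s := Finset.univ) (f := fun v => W.bhatPair v (v + d))
  have h2 := sq_sum_le_card_mul_sum_sq (s := Finset.univ) (f := fun v => W.tvPair v (v + d))
  have h3 := Finset.sum_le_sum fun (v : Pauli) (_ : v ∈ Finset.univ) =>
    W.bhatPair_sq_add_tvPair_sq_le v (v + d)
  simp only [Finset.sum_add_distrib] at h3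
  simp at h1 h2 h3
  unfold bhat tv
  linarith

theorem bhat_le_one (d : Pauli) : W.bhat d ≤ 1 := by
  nlinarith [W.bhat_sq_add_tv_sq_le d, sq_nonneg (W.tv d), W.bhat_nonneg d]

theorem tv_triangle (d d' : Pauli) : W.tv (d + d') ≤ W.tv d + W.tv d' := by
  have h1 := Finset.sum_le_sum fun (v : Pauli) (_ : v ∈ Finset.univ) =>
    W.tvPair_triangle v (v + d) (v + d + d')
  have h2 := Equiv.sum_comp (Equiv.addRight d) (fun v : Pauli => W.tvPair v (v + d'))
  simp only [Equiv.coe_addRight] at h2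
  rw [Finset.sum_add_distrib, h2] at h1
  unfold tv
  simp only [← add_assoc]
  linarith

/-! ### The parameters of the good and the bad channel -/

theorem bhatPair_good (v v' : Pauli) :
    W.good.bhatPair v v' = ∑ a : Pauli, ∑ y : W.Out × W.Out,
      Real.sqrt (1 / 4 * W.combine y.1 y.2 a v * (1 / 4 * W.combine y.1 y.2 a v')) :=
  Fintype.sum_prod_type (fun y : Pauli × (W.Out × W.Out) =>
    Real.sqrt (1 / 4 * W.combine y.2.1 y.2.2 y.1 v * (1 / 4 * W.combine y.2.1 y.2.2 y.1 v')))

theorem bhatPair_bad (a a' : Pauli) :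
    W.bad.bhatPair a a' = ∑ y : W.Out × W.Out,
      Real.sqrt ((∑ v, 1 / 4 * W.combine y.1 y.2 a v) * ∑ v, 1 / 4 * W.combine y.1 y.2 a' v) :=
  rfl

theorem tvPair_good (v v' : Pauli) :
    W.good.tvPair v v' = 1 / 2 * ∑ a : Pauli, ∑ y : W.Out × W.Out,
      |1 / 4 * W.combine y.1 y.2 a v - 1 / 4 * W.combine y.1 y.2 a v'| :=
  congrArg (1 / 2 * ·) (Fintype.sum_prod_type (fun y : Pauli × (W.Out × W.Out) =>
    |1 / 4 * W.combine y.2.1 y.2.2 y.1 v - 1 / 4 * W.combine y.2.1 y.2.2 y.1 v'|))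

theorem tvPair_bad (a a' : Pauli) :
    W.bad.tvPair a a' = 1 / 2 * ∑ y : W.Out × W.Out,
      |(∑ v, 1 / 4 * W.combine y.1 y.2 a v) - ∑ v, 1 / 4 * W.combine y.1 y.2 a' v| :=
  rfl

theorem sum_sqrt_combine (w w' : Pauli × Pauli) :
    ∑ y : W.Out × W.Out, Real.sqrt (W.combine y.1 y.2 w.1 w.2 * W.combine y.1 y.2 w'.1 w'.2) =
      W.bhatPair (gammaL w).1 (gammaL w').1 * W.bhatPair (gammaL w).2 (gammaL w').2 := by
  simp only [bhatPair, Finset.sum_mul_sum, Fintype.sum_prod_type]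
  refine Finset.sum_congr rfl fun y₁ _ => Finset.sum_congr rfl fun y₂ _ => ?_
  rw [← Real.sqrt_mul (mul_nonneg (W.prob_nonneg _ _) (W.prob_nonneg _ _))]
  unfold combine
  congr 1
  ring

theorem sum_sum_sqrt_combine (d : Pauli × Pauli) :
    ∑ w : Pauli × Pauli, ∑ y : W.Out × W.Out, Real.sqrt (W.combine y.1 y.2 w.1 w.2 *
      W.combine y.1 y.2 (w + d).1 (w + d).2) =
      16 * (W.bhat (gammaL d).1 * W.bhat (gammaL d).2) := by
  have h := fun w : Pauli × Pauli => W.sum_sqrt_combine w (w + d)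
  simp only [gammaL_add, Prod.fst_add (gammaL _), Prod.snd_add (gammaL _)] at h
  rw [Finset.sum_congr rfl fun w _ => h w, sum_gammaL (fun p => W.bhatPair p (p + (gammaL d).1))
    (fun p => W.bhatPair p (p + (gammaL d).2))]
  unfold bhat
  ring

theorem bhat_good (d : Pauli) :
    W.good.bhat d = W.bhat (gammaL (0, d)).1 * W.bhat (gammaL (0, d)).2 := by
  have h := W.sum_sum_sqrt_combine (0, d)
  have h' : ∑ v : Pauli, W.good.bhatPair v (v + d) = 1 / 4 * ∑ w : Pauli × Pauli,
      ∑ y : W.Out × W.Out, Real.sqrt (W.combine y.1 y.2 w.1 w.2 *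
      W.combine y.1 y.2 (w + (0, d)).1 (w + (0, d)).2) := by
    rw [Fintype.sum_prod_type_right (α₁ := Pauli) (α₂ := Pauli), Finset.mul_sum]
    refine Finset.sum_congr rfl fun v _ => ?_
    rw [bhatPair_good, Finset.mul_sum]
    refine Finset.sum_congr rfl fun a _ => ?_
    rw [Finset.mul_sum]
    refine Finset.sum_congr rfl fun y _ => ?_
    simp only [Prod.fst_add, Prod.snd_add, add_zero]
    rw [mul_mul_mul_comm, Real.sqrt_mul (by norm_num), Real.sqrt_mul_self (by norm_num)]
  unfold bhat at h ⊢
  rw [h', h]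
  ring

/-- Subadditivity of the square root, applied to the two sums over the second input, whose values
differ by `e`. -/
theorem bhat_bad_le (d : Pauli) :
    W.bad.bhat d ≤ ∑ e : Pauli, W.bhat (gammaL (d, e)).1 * W.bhat (gammaL (d, e)).2 := by
  have h : ∑ a : Pauli, W.bad.bhatPair a (a + d) ≤ 1 / 4 * ∑ e : Pauli, ∑ w : Pauli × Pauli,
      ∑ y : W.Out × W.Out, Real.sqrt (W.combine y.1 y.2 w.1 w.2 *
      W.combine y.1 y.2 (w + (d, e)).1 (w + (d, e)).2) := by
    rw [Finset.sum_comm]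
    simp only [Fintype.sum_prod_type (α₁ := Pauli) (α₂ := Pauli), Finset.mul_sum]
    refine Finset.sum_le_sum fun a _ => ?_
    rw [bhatPair_bad]
    simp only [Finset.sum_comm (s := (Finset.univ : Finset Pauli))
      (t := (Finset.univ : Finset (W.Out × W.Out)))]
    refine Finset.sum_le_sum fun y _ => ?_
    simp only [← Finset.mul_sum, Prod.fst_add, Prod.snd_add]
    rw [mul_mul_mul_comm, Real.sqrt_mul (by norm_num), Real.sqrt_mul_self (by norm_num)]
    refine mul_le_mul_of_nonneg_left ?_ (by norm_num)
    rw [Finset.sum_mul]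
    refine (sqrt_sum_le _ _ fun v => mul_nonneg (W.combine_nonneg _ _ _ _)
      (Finset.sum_nonneg fun _ _ => W.combine_nonneg _ _ _ _)).trans ?_
    refine Finset.sum_le_sum fun v _ => ?_
    rw [← Equiv.sum_comp (Equiv.addLeft v) (fun v' => W.combine y.1 y.2 (a + d) v'),
      Finset.mul_sum]
    exact sqrt_sum_le _ _ fun e => mul_nonneg (W.combine_nonneg _ _ _ _)
      (W.combine_nonneg _ _ _ _)
  simp only [sum_sum_sqrt_combine, ← Finset.mul_sum] at h
  have : W.bad.bhat d = 1 / 4 * ∑ a : Pauli, W.bad.bhatPair a (a + d) := rfl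
  rw [this]
  linarith

/-- The total variation distance of product distributions: the overlaps `1 - T` are at least
multiplied. -/
theorem sum_abs_combine_le (w w' : Pauli × Pauli) :
    1 / 2 * ∑ y : W.Out × W.Out, |W.combine y.1 y.2 w.1 w.2 - W.combine y.1 y.2 w'.1 w'.2| ≤
      1 - (1 - W.tvPair (gammaL w).1 (gammaL w').1) *
        (1 - W.tvPair (gammaL w).2 (gammaL w').2) := by
  have h : ∀ a b : ℝ, |a - b| = a + b - 2 * min a b := fun a b => by
    rcases le_total a b with h | h
    · rw [min_eq_left h, abs_of_nonpos (by linarith)]; ring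
    · rw [min_eq_right h, abs_of_nonneg (by linarith)]; ring
  have hmin : (1 - W.tvPair (gammaL w).1 (gammaL w').1) *
      (1 - W.tvPair (gammaL w).2 (gammaL w').2) ≤
      ∑ y : W.Out × W.Out, min (W.combine y.1 y.2 w.1 w.2) (W.combine y.1 y.2 w'.1 w'.2) := by
    rw [one_sub_tvPair, one_sub_tvPair, Finset.sum_mul_sum, Fintype.sum_prod_type]
    refine Finset.sum_le_sum fun y₁ _ => Finset.sum_le_sum fun y₂ _ => ?_
    have h0 := fun y w => W.prob_nonneg y w
    exact le_min
      (mul_le_mul (min_le_left _ _) (min_le_left _ _) (le_min (h0 _ _) (h0 _ _)) (h0 _ _))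
      (mul_le_mul (min_le_right _ _) (min_le_right _ _) (le_min (h0 _ _) (h0 _ _)) (h0 _ _))
  simp only [h, Finset.sum_sub_distrib, Finset.sum_add_distrib, ← Finset.mul_sum, combine_sum]
  linarith

theorem sum_sum_abs_combine_le (d : Pauli × Pauli) :
    ∑ w : Pauli × Pauli, ∑ y : W.Out × W.Out, |W.combine y.1 y.2 w.1 w.2 -
      W.combine y.1 y.2 (w + d).1 (w + d).2| ≤
      32 * (1 - (1 - W.tv (gammaL d).1) * (1 - W.tv (gammaL d).2)) := by
  have h := Finset.sum_le_sum fun (w : Pauli × Pauli) (_ : w ∈ Finset.univ) =>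
    W.sum_abs_combine_le w (w + d)
  simp only [Finset.sum_sub_distrib, gammaL_add, Prod.fst_add, Prod.snd_add,
    ← Finset.mul_sum] at h
  rw [sum_gammaL (fun p => 1 - W.tvPair p (p + (gammaL d).1))
    (fun p => 1 - W.tvPair p (p + (gammaL d).2))] at h
  simp only [Finset.sum_sub_distrib] at h
  simp at h
  unfold tv
  simp only [Prod.fst_add, Prod.snd_add]
  linarith

theorem sum_tvPair_good (d : Pauli) :
    ∑ v : Pauli, W.good.tvPair v (v + d) = 1 / 8 * ∑ w : Pauli × Pauli,
      ∑ y : W.Out × W.Out, |W.combine y.1 y.2 w.1 w.2 -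
      W.combine y.1 y.2 (w + (0, d)).1 (w + (0, d)).2| := by
  rw [Fintype.sum_prod_type_right (α₁ := Pauli) (α₂ := Pauli), Finset.mul_sum]
  refine Finset.sum_congr rfl fun v _ => ?_
  rw [tvPair_good, Finset.mul_sum, Finset.mul_sum]
  refine Finset.sum_congr rfl fun a _ => ?_
  rw [Finset.mul_sum, Finset.mul_sum]
  refine Finset.sum_congr rfl fun y _ => ?_
  simp only [Prod.fst_add, Prod.snd_add, add_zero]
  rw [← mul_sub, abs_mul, abs_of_pos (by norm_num : (0 : ℝ) < 1 / 4)]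
  ring

theorem tv_good_le (d : Pauli) :
    W.good.tv d ≤ 1 - (1 - W.tv (gammaL (0, d)).1) * (1 - W.tv (gammaL (0, d)).2) := by
  have h := W.sum_sum_abs_combine_le (0, d)
  have h' := W.sum_tvPair_good d
  have h'' : W.good.tv d = 1 / 4 * ∑ v : Pauli, W.good.tvPair v (v + d) := rfl
  rw [h'', h']
  linarith

/-- The uniformly random second input may be shifted by any `e`. -/
theorem tv_bad_le (d e : Pauli) :
    W.bad.tv d ≤ 1 - (1 - W.tv (gammaL (d, e)).1) * (1 - W.tv (gammaL (d, e)).2) := by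
  have h : ∑ a : Pauli, W.bad.tvPair a (a + d) ≤ 1 / 8 * ∑ w : Pauli × Pauli,
      ∑ y : W.Out × W.Out, |W.combine y.1 y.2 w.1 w.2 -
      W.combine y.1 y.2 (w + (d, e)).1 (w + (d, e)).2| := by
    rw [Fintype.sum_prod_type (α₁ := Pauli) (α₂ := Pauli), Finset.mul_sum]
    refine Finset.sum_le_sum fun a _ => ?_
    rw [tvPair_bad]
    rw [Finset.sum_comm, Finset.mul_sum, Finset.mul_sum]
    refine Finset.sum_le_sum fun y _ => ?_
    simp only [Prod.fst_add, Prod.snd_add]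
    rw [← Equiv.sum_comp (Equiv.addRight e) (fun v' => 1 / 4 * W.combine y.1 y.2 (a + d) v'),
      ← Finset.sum_sub_distrib]
    simp only [Equiv.coe_addRight, ← mul_sub]
    rw [← Finset.mul_sum, abs_mul, abs_of_pos (by norm_num : (0 : ℝ) < 1 / 4)]
    have := Finset.abs_sum_le_sum_abs
      (fun v => W.combine y.1 y.2 a v - W.combine y.1 y.2 (a + d) (v + e)) Finset.univ
    linarith
  have h' := W.sum_sum_abs_combine_le (d, e)
  have h'' : W.bad.tv d = 1 / 4 * ∑ v : Pauli, W.bad.tvPair v (v + d) := rfl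
  rw [h'']
  linarith

end Chan

theorem sum_pauli (f : Pauli → ℝ) :
    ∑ v, f v = f (0, 0) + f (0, 1) + f (1, 0) + f (1, 1) := by
  have h : (Finset.univ : Finset Pauli) = {(0, 0), (0, 1), (1, 0), (1, 1)} := by decide
  rw [h, Finset.sum_insert (by decide), Finset.sum_insert (by decide),
    Finset.sum_insert (by decide), Finset.sum_singleton]
  ring

/-! ### The parameters of a polarization step for the three Pauli classes -/

namespace Chan

variable (W : Chan.{u})

/-- `Z_1` (for `false`) and `Z_2` (for `true`), each joined with `Z_3` by a maximum. -/
def zMax (j : Bool) : ℝ := max (W.bhat (if j then (1, 0) else (0, 1))) (W.bhat (1, 1))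

/-- The total variation counterparts of `Z_1` (for `false`) and `Z_2` (for `true`). -/
def tvAxis (j : Bool) : ℝ := W.tv (if j then (1, 0) else (0, 1))

theorem zMax_nonneg (j : Bool) : 0 ≤ W.zMax j := le_max_of_le_right (W.bhat_nonneg _)

theorem bhat_good_one : W.good.bhat (0, 1) = W.bhat (1, 0) := by
  rw [bhat_good, show gammaL (0, (0, 1)) = ((0, 0), (1, 0)) by decide, bhat_zero, one_mul]

theorem bhat_good_two : W.good.bhat (1, 0) = W.bhat (0, 1) ^ 2 := by
  rw [bhat_good, show gammaL (0, (1, 0)) = ((0, 1), (0, 1)) by decide, sq]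

theorem bhat_good_three : W.good.bhat (1, 1) = W.bhat (0, 1) * W.bhat (1, 1) := by
  rw [bhat_good, show gammaL (0, (1, 1)) = ((0, 1), (1, 1)) by decide]

theorem bhat_bad_one_le :
    W.bad.bhat (0, 1) ≤ W.bhat (1, 0) + W.bhat (1, 0) * W.bhat (1, 0) +
      W.bhat (1, 1) * W.bhat (1, 1) + W.bhat (1, 1) * W.bhat (0, 1) := by
  refine (W.bhat_bad_le _).trans (le_of_eq ?_)
  rw [sum_pauli, show gammaL ((0, 1), (0, 0)) = ((1, 0), (1, 0)) by decide,
    show gammaL ((0, 1), (0, 1)) = ((1, 0), (0, 0)) by decide,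
    show gammaL ((0, 1), (1, 0)) = ((1, 1), (1, 1)) by decide,
    show gammaL ((0, 1), (1, 1)) = ((1, 1), (0, 1)) by decide, bhat_zero]
  ring

theorem bhat_bad_two_le :
    W.bad.bhat (1, 0) ≤ 2 * W.bhat (0, 1) + W.bhat (0, 1) * W.bhat (1, 0) + W.bhat (1, 1) := by
  refine (W.bhat_bad_le _).trans (le_of_eq ?_)
  rw [sum_pauli, show gammaL ((1, 0), (0, 0)) = ((0, 1), (0, 0)) by decide,
    show gammaL ((1, 0), (0, 1)) = ((0, 1), (1, 0)) by decide,
    show gammaL ((1, 0), (1, 0)) = ((0, 0), (0, 1)) by decide,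
    show gammaL ((1, 0), (1, 1)) = ((0, 0), (1, 1)) by decide, bhat_zero]
  ring

theorem bhat_bad_three_le :
    W.bad.bhat (1, 1) ≤ W.bhat (1, 1) + 2 * (W.bhat (1, 0) * W.bhat (1, 1)) +
      W.bhat (0, 1) * W.bhat (1, 0) := by
  refine (W.bhat_bad_le _).trans (le_of_eq ?_)
  rw [sum_pauli, show gammaL ((1, 1), (0, 0)) = ((1, 1), (1, 0)) by decide,
    show gammaL ((1, 1), (0, 1)) = ((1, 1), (0, 0)) by decide,
    show gammaL ((1, 1), (1, 0)) = ((1, 0), (1, 1)) by decide,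
    show gammaL ((1, 1), (1, 1)) = ((1, 0), (0, 1)) by decide, bhat_zero]
  ring

/-- The total variation distance between the two values of the second bit of the input, when the
first bit is uniformly random. -/
def tvSnd : ℝ :=
  1 / 4 * ∑ y, |W.prob y (0, 0) + W.prob y (1, 0) - (W.prob y (0, 1) + W.prob y (1, 1))|

theorem tvSnd_le_tv_one : W.tvSnd ≤ W.tv (0, 1) := by
  have h : W.tv (0, 1) = 1 / 2 * (W.tvPair (0, 0) (0, 1) + W.tvPair (1, 0) (1, 1)) := by
    unfold tv
    rw [sum_pauli]
    simp only [Prod.mk_add_mk, add_zero, zero_add, show (1 : ZMod 2) + 1 = 0 by decide]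
    rw [W.tvPair_comm (0, 1), W.tvPair_comm (1, 1)]
    ring
  rw [h]
  unfold tvSnd tvPair
  rw [← mul_add, ← Finset.sum_add_distrib, ← mul_assoc, show (1 / 2 : ℝ) * (1 / 2) = 1 / 4 by
    norm_num]
  refine mul_le_mul_of_nonneg_left (Finset.sum_le_sum fun y _ => ?_) (by norm_num)
  rw [add_sub_add_comm]
  exact abs_add_le _ _

theorem tvSnd_le_tv_three : W.tvSnd ≤ W.tv (1, 1) := by
  have h : W.tv (1, 1) = 1 / 2 * (W.tvPair (0, 0) (1, 1) + W.tvPair (1, 0) (0, 1)) := by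
    unfold tv
    rw [sum_pauli]
    simp only [Prod.mk_add_mk, zero_add, show (1 : ZMod 2) + 1 = 0 by decide]
    rw [W.tvPair_comm (0, 1), W.tvPair_comm (1, 1)]
    ring
  rw [h]
  unfold tvSnd tvPair
  rw [← mul_add, ← Finset.sum_add_distrib, ← mul_assoc, show (1 / 2 : ℝ) * (1 / 2) = 1 / 4 by
    norm_num]
  refine mul_le_mul_of_nonneg_left (Finset.sum_le_sum fun y _ => ?_) (by norm_num)
  rw [add_comm (W.prob y (0, 1)), add_sub_add_comm]
  exact abs_add_le _ _

/-- In the bad channel, the first bit of the input is added to a uniformly random bit that is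
seen through the second copy of `W`; total variation distances multiply. -/
theorem tvPair_bad_two (a : Pauli) :
    W.bad.tvPair a (a + (1, 0)) = W.tvPair (a.2, a.1) ((a.2, a.1) + (0, 1)) * W.tvSnd := by
  have h : ∀ y : W.Out × W.Out, (∑ v, 1 / 4 * W.combine y.1 y.2 a v) -
      ∑ v, 1 / 4 * W.combine y.1 y.2 (a + (1, 0)) v =
      1 / 4 * (W.prob y.1 (a.2, a.1) - W.prob y.1 ((a.2, a.1) + (0, 1))) *
      (W.prob y.2 (0, 0) + W.prob y.2 (1, 0) - (W.prob y.2 (0, 1) + W.prob y.2 (1, 1))) := by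
    intro y
    have h2 : ∀ x : ZMod 2, x = 0 ∨ x = 1 := by decide
    obtain ⟨a, b⟩ := a
    rcases h2 a with rfl | rfl <;> rcases h2 b with rfl | rfl <;>
      simp only [sum_pauli, combine, gammaL, Prod.mk_add_mk, add_zero, zero_add,
        show (1 : ZMod 2) + 1 = 0 by decide] <;> ring
  rw [tvPair_bad]
  simp only [h, abs_mul]
  unfold tvPair tvSnd
  rw [Fintype.sum_prod_type, mul_mul_mul_comm, Finset.sum_mul_sum, Finset.mul_sum,
    Finset.mul_sum]
  refine Finset.sum_congr rfl fun y₁ _ => ?_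
  rw [Finset.mul_sum, Finset.mul_sum]
  refine Finset.sum_congr rfl fun y₂ _ => ?_
  rw [abs_of_pos (by norm_num : (0 : ℝ) < 1 / 4)]
  ring

theorem tv_bad_two : W.bad.tv (1, 0) = W.tv (0, 1) * W.tvSnd := by
  have h : ∑ a : Pauli, W.tvPair (a.2, a.1) ((a.2, a.1) + (0, 1)) =
      ∑ v : Pauli, W.tvPair v (v + (0, 1)) :=
    Equiv.sum_comp (Equiv.prodComm (ZMod 2) (ZMod 2))
      (fun v : Pauli => W.tvPair v (v + (0, 1)))
  unfold tv
  simp only [tvPair_bad_two, ← Finset.sum_mul]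
  rw [h]
  ring

theorem tv_zero : W.tv (0, 0) = 0 := by
  have : ((0, 0) : Pauli) = 0 := rfl
  simp [tv, this, tvPair_self]

theorem tv_bad_one_le : W.bad.tv (0, 1) ≤ W.tv (1, 0) := by
  have h := W.tv_bad_le (0, 1) (0, 1)
  rw [show gammaL ((0, 1), (0, 1)) = ((1, 0), (0, 0)) by decide, tv_zero] at h
  linarith

theorem tv_good_two_le : W.good.tv (1, 0) ≤ 2 * W.tv (0, 1) - W.tv (0, 1) ^ 2 := by
  have h := W.tv_good_le (1, 0)
  rw [show gammaL (0, (1, 0)) = ((0, 1), (0, 1)) by decide] at h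
  linarith

theorem tv_good_one : W.good.tv (0, 1) = W.tv (1, 0) := by
  have h : ∀ w : Pauli × Pauli, ∑ y : W.Out × W.Out, |W.combine y.1 y.2 w.1 w.2 -
      W.combine y.1 y.2 (w + (0, (0, 1))).1 (w + (0, (0, 1))).2| =
      (1 : ℝ) * (2 * W.tvPair (gammaL w).2 ((gammaL w).2 + (1, 0))) := by
    intro w
    have h1 : gammaL (w + (0, (0, 1))) = ((gammaL w).1, (gammaL w).2 + (1, 0)) := by
      rw [gammaL_add, show gammaL (0, (0, 1)) = (0, (1, 0)) by decide]
      ext <;> simp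
    simp only [combine]
    rw [h1]
    simp only [← mul_sub, abs_mul, abs_of_nonneg (W.prob_nonneg _ _)]
    rw [Fintype.sum_prod_type]
    simp only [← Finset.mul_sum, ← Finset.sum_mul]
    rw [W.prob_sum]
    unfold tvPair
    ring
  have h2 : W.good.tv (0, 1) = 1 / 4 * ∑ v : Pauli, W.good.tvPair v (v + (0, 1)) := rfl
  rw [h2, sum_tvPair_good, Finset.sum_congr rfl fun w _ => h w,
    sum_gammaL (fun _ => 1) (fun q => 2 * W.tvPair q (q + (1, 0))), ← Finset.mul_sum, tv]
  simp
  ring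

/-! ### Families of parameters that are squared by one of the two steps -/

/-- A pair of parameters that are exchanged, up to the factor `4`, by each step; in addition, the
step `g` squares `X false` while turning it into `X true`. -/
structure SquaredBy (X : Bool → Chan.{u} → ℝ) (g : Bool) : Prop where
  nonneg : ∀ j W, 0 ≤ X j W
  step_le : ∀ j W b, X j (W.step b) ≤ 4 * X (!j) W
  step_sq : ∀ W, X true (W.step g) ≤ X false W ^ 2

theorem step_true : W.step true = W.good := rfl

theorem step_false : W.step false = W.bad := rfl

theorem squaredBy_zMax : SquaredBy.{u} (fun j W => W.zMax j) true where
  nonneg j W := W.zMax_nonneg j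
  step_le j W b := by
    have h0 := fun d => W.bhat_nonneg d
    have h1 := fun d => W.bhat_le_one d
    have h1u := mul_le_of_le_one_right (h0 (1, 0)) (h1 (1, 0))
    have h2u := mul_le_of_le_one_right (h0 (1, 1)) (h1 (1, 1))
    have h3u := mul_le_of_le_one_right (h0 (1, 1)) (h1 (0, 1))
    have h4u := mul_le_of_le_one_right (h0 (0, 1)) (h1 (1, 0))
    have h5u := mul_le_of_le_one_left (h0 (1, 0)) (h1 (0, 1))
    have h6u := mul_le_of_le_one_left (h0 (1, 1)) (h1 (1, 0))
    have h7u := mul_le_of_le_one_left (h0 (1, 1)) (h1 (0, 1))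
    have h8u := mul_le_of_le_one_right (h0 (0, 1)) (h1 (0, 1))
    have a1 := W.bhat_bad_one_le
    have a2 := W.bhat_bad_two_le
    have a3 := W.bhat_bad_three_le
    have m1 := le_max_left (W.bhat (0, 1)) (W.bhat (1, 1))
    have m2 := le_max_right (W.bhat (0, 1)) (W.bhat (1, 1))
    have m3 := le_max_left (W.bhat (1, 0)) (W.bhat (1, 1))
    have m4 := le_max_right (W.bhat (1, 0)) (W.bhat (1, 1))
    have p1 := h0 (0, 1)
    have p2 := h0 (1, 0)
    have p3 := h0 (1, 1)
    cases j <;> cases b <;>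
      simp only [zMax, step_true, step_false, bhat_good_one, bhat_good_two, bhat_good_three,
        Bool.not_true, Bool.not_false, if_true, if_false, Bool.false_eq_true, sq] <;>
      refine max_le ?_ ?_ <;> linarith
  step_sq W := by
    simp only [zMax, step_true, bhat_good_two, bhat_good_three, if_true, if_false,
      Bool.false_eq_true]
    have m1 := le_max_left (W.bhat (0, 1)) (W.bhat (1, 1))
    have m2 := le_max_right (W.bhat (0, 1)) (W.bhat (1, 1))
    refine max_le (pow_le_pow_left₀ (W.bhat_nonneg _) m1 2) ?_
    rw [sq]
    exact mul_le_mul m1 m2 (W.bhat_nonneg _) ((W.bhat_nonneg _).trans m1)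

theorem squaredBy_tvAxis : SquaredBy.{u} (fun j W => W.tvAxis j) false where
  nonneg j W := W.tv_nonneg _
  step_le j W b := by
    have p1 := W.tv_nonneg (0, 1)
    have p2 := W.tv_nonneg (1, 0)
    have q := W.tv_le_one (0, 1)
    have a1 := W.tv_bad_one_le
    have a2 := W.tv_good_two_le
    have a3 := mul_le_mul_of_nonneg_left W.tvSnd_le_tv_one p1
    have a4 := mul_le_of_le_one_right p1 q
    have a5 := sq_nonneg (W.tv (0, 1))
    cases j <;> cases b <;>
      simp only [tvAxis, step_true, step_false, tv_good_one, tv_bad_two,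
        Bool.not_true, Bool.not_false, if_true, if_false, Bool.false_eq_true] <;>
      linarith
  step_sq W := by
    simp only [tvAxis, step_false, tv_bad_two, if_true, if_false, Bool.false_eq_true]
    rw [sq]
    exact mul_le_mul_of_nonneg_left W.tvSnd_le_tv_one (W.tv_nonneg _)

/-! ### Averages over the virtual channels -/

/-- The average of `g` over the `2 ^ n` virtual channels of `W` with `n` steps. -/
def pathAvg : ℕ → (Chan.{u} → ℝ) → Chan.{u} → ℝ
  | 0, g, W => g W
  | n + 1, g, W => (pathAvg n g W.bad + pathAvg n g W.good) / 2

theorem virt_cons {n : ℕ} (b : Bool) (i : Fin n → Bool) :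
    W.virt (Fin.cons b i : Fin (n + 1) → Bool) = (W.step b).virt i := by
  simp [virt, List.ofFn_succ]

theorem sum_virt (g : Chan.{u} → ℝ) (n : ℕ) (W : Chan.{u}) :
    ∑ i : Fin n → Bool, g (W.virt i) = 2 ^ n * pathAvg n g W := by
  induction n generalizing W with
  | zero => simp [virt, pathAvg]
  | succ n ih =>
    rw [← Equiv.sum_comp (Fin.consEquiv fun _ => Bool), Fintype.sum_prod_type]
    have h : ∀ (b : Bool) (i : Fin n → Bool), W.virt (Fin.consEquiv (fun _ => Bool) (b, i)) =
        (W.step b).virt i := fun b i => W.virt_cons b i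
    simp only [h, ih, Fintype.sum_bool, pathAvg, step_true, step_false]
    ring

theorem pathAvg_add (m n : ℕ) (g : Chan.{u} → ℝ) (W : Chan.{u}) :
    pathAvg (m + n) g W = pathAvg m (pathAvg n g) W := by
  induction m generalizing W with
  | zero => simp [pathAvg]
  | succ m ih => rw [Nat.add_right_comm]; simp only [pathAvg, ih]

theorem pathAvg_succ (n : ℕ) (g : Chan.{u} → ℝ) (W : Chan.{u}) :
    pathAvg (n + 1) g W = pathAvg n (fun V => (g V.bad + g V.good) / 2) W :=
  pathAvg_add n 1 g W

theorem pathAvg_mono {g g' : Chan.{u} → ℝ} (h : ∀ V, g V ≤ g' V) (n : ℕ) (W : Chan.{u}) :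
    pathAvg n g W ≤ pathAvg n g' W := by
  induction n generalizing W with
  | zero => exact h W
  | succ n ih => simp only [pathAvg]; linarith [ih W.bad, ih W.good]

theorem pathAvg_const (c : ℝ) (n : ℕ) (W : Chan.{u}) : pathAvg n (fun _ => c) W = c := by
  induction n generalizing W with
  | zero => rfl
  | succ n ih => simp [pathAvg, ih]

theorem pathAvg_add_fun (g g' : Chan.{u} → ℝ) (n : ℕ) (W : Chan.{u}) :
    pathAvg n (fun V => g V + g' V) W = pathAvg n g W + pathAvg n g' W := by
  induction n generalizing W with
  | zero => rfl
  | succ n ih => simp only [pathAvg, ih]; ring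

theorem pathAvg_mul (c : ℝ) (g : Chan.{u} → ℝ) (n : ℕ) (W : Chan.{u}) :
    pathAvg n (fun V => c * g V) W = c * pathAvg n g W := by
  induction n generalizing W with
  | zero => rfl
  | succ n ih => simp only [pathAvg, ih]; ring

theorem pathAvg_nonneg {g : Chan.{u} → ℝ} (h : ∀ V, 0 ≤ g V) (n : ℕ) (W : Chan.{u}) :
    0 ≤ pathAvg n g W := by
  simpa [pathAvg_const] using pathAvg_mono (g := fun _ => 0) h n W

/-! ### Polarization -/

/-- A measure of how far the total variation parameter is from `{0, 1}`; for
`f t = 2 t - t ^ 2`, it is the excess of `f t` over the mean of `f (t ^ 2)` and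
`f (2 t - t ^ 2)`. -/
def unpol (j : Bool) : ℝ := (W.tvAxis j * (1 - W.tvAxis j)) ^ 2

theorem unpol_nonneg (j : Bool) : 0 ≤ W.unpol j := sq_nonneg _

/-- The quantity whose average over the virtual channels decreases. It uses the function
`t ↦ 2 t - t ^ 2`, which is increasing and strictly concave on `[0, 1]`. -/
def potential : ℝ := ∑ j : Bool, (2 * W.tvAxis j - W.tvAxis j ^ 2)

theorem potential_nonneg : 0 ≤ W.potential :=
  Finset.sum_nonneg fun j _ => by
    have h0 := W.tv_nonneg (if j then (1, 0) else (0, 1))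
    have h1 := W.tv_le_one (if j then (1, 0) else (0, 1))
    unfold tvAxis
    nlinarith

theorem potential_step :
    (W.bad.potential + W.good.potential) / 2 ≤ W.potential - W.unpol false := by
  have mono : ∀ {s t : ℝ}, s ≤ t → t ≤ 1 → 2 * s - s ^ 2 ≤ 2 * t - t ^ 2 := fun {s t} h h1 => by
    nlinarith
  have p1 := W.tv_nonneg (0, 1)
  have q1 := W.tv_le_one (0, 1)
  have q2 := W.tv_le_one (1, 0)
  have h1 := mono W.tv_bad_one_le q2
  have h2 := mono W.tv_good_two_le (by nlinarith)
  have h3 : W.bad.tv (1, 0) ≤ W.tv (0, 1) ^ 2 := squaredBy_tvAxis.step_sq W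
  have h4 := mono h3 (by nlinarith)
  simp only [potential, unpol, tvAxis, Fintype.sum_bool, if_true, if_false, Bool.false_eq_true,
    tv_good_one]
  nlinarith

/-- The sum over `n` of the average of `(T_1 (1 - T_1)) ^ 2` telescopes against the potential. -/
theorem tendsto_pathAvg_unpol (j : Bool) :
    Filter.Tendsto (fun n => pathAvg n (fun V => V.unpol j) W) Filter.atTop (𝓝 0) := by
  have hfalse : Filter.Tendsto (fun n => pathAvg n (fun V => V.unpol false) W)
      Filter.atTop (𝓝 0) := by
    have hle : ∀ n, pathAvg n (fun V => V.unpol false) W ≤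
        pathAvg n potential W - pathAvg (n + 1) potential W := by
      intro n
      rw [pathAvg_succ]
      have := pathAvg_mono (g := fun V => (V.bad.potential + V.good.potential) / 2 + V.unpol false)
        (g' := potential) (fun V => by linarith [V.potential_step]) n W
      rw [pathAvg_add_fun] at this
      linarith
    have hanti : Antitone fun n => pathAvg n potential W := antitone_nat_of_succ_le fun n => by
      linarith [hle n, pathAvg_nonneg (fun V => V.unpol_nonneg false) n W]
    have hlim := tendsto_atTop_ciInf hanti ⟨0, by
      rintro _ ⟨n, rfl⟩
      exact pathAvg_nonneg potential_nonneg n W⟩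
    have hdiff := hlim.sub (hlim.comp (Filter.tendsto_add_atTop_nat 1))
    rw [sub_self] at hdiff
    exact squeeze_zero (fun n => pathAvg_nonneg (fun V => V.unpol_nonneg false) n W) hle hdiff
  cases j with
  | false => exact hfalse
  | true =>
    -- the good step hands `T_2` over to `T_1`
    have h := ((hfalse.comp (Filter.tendsto_add_atTop_nat 1)).const_mul 2)
    rw [mul_zero] at h
    refine squeeze_zero (fun n => pathAvg_nonneg (fun V => V.unpol_nonneg true) n W)
      (fun n => ?_) h
    rw [Function.comp, pathAvg_succ, ← pathAvg_mul]
    refine pathAvg_mono (fun V => ?_) n W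
    have h1 : V.good.unpol false = V.unpol true := by simp [unpol, tvAxis, tv_good_one]
    have := V.bad.unpol_nonneg false
    linarith

/-- A total variation parameter close to `1` makes the Bhattacharyya parameter small. -/
theorem bhat_le_of_tv {ε x : ℝ} (d : Pauli) (hε : 0 ≤ ε) (h : 1 - x ≤ W.tv d)
    (hx : 2 * x ≤ ε ^ 2) : W.bhat d ≤ ε := by
  refine le_of_sq_le_sq ?_ hε
  nlinarith [W.bhat_sq_add_tv_sq_le d, W.tv_le_one d, sq_nonneg (1 - W.tv d)]

/-- If `T_1` and `T_2` are both close to `0` or `1` after a polarization step, then each index is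
polarized, including `Z_3`. That the channel results from a step matters when `T_1` and `T_2`
are both close to `1`: it excludes a `Z_3` that is not small. -/
theorem polarized_step {ε : ℝ} (hε : 0 < ε) (hε1 : ε ≤ 1) (b : Bool)
    (h : ∀ j, (W.step b).tvAxis j ≤ ε ^ 4 / 128 ∨ 1 - ε ^ 4 / 128 ≤ (W.step b).tvAxis j)
    (j : Bool) : (W.step b).zMax j ≤ ε ∨ (W.step b).tvAxis j ≤ ε := by
  have e2 : ε ^ 2 ≤ ε := by nlinarith
  have e4 : ε ^ 4 ≤ ε ^ 2 := by nlinarith [sq_nonneg ε]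
  have e0 : 0 < ε ^ 4 := by positivity
  have hf := h false
  have ht := h true
  simp only [tvAxis, zMax, if_true, if_false, Bool.false_eq_true] at hf ht ⊢
  have htri1 := (W.step b).tv_triangle (1, 0) (1, 1)
  have htri2 := (W.step b).tv_triangle (0, 1) (1, 1)
  rw [show ((1, 0) : Pauli) + (1, 1) = (0, 1) by decide] at htri1
  rw [show ((0, 1) : Pauli) + (1, 1) = (1, 0) by decide] at htri2
  -- when exactly one of `T_1`, `T_2` is small, the triangle inequality makes `T_3` large
  rcases hf with hf | hf
  · rcases ht with ht | ht
    · cases j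
      · exact Or.inr (by simpa using by linarith)
      · exact Or.inr (by simpa using by linarith)
    · cases j
      · exact Or.inr (by simpa using by linarith)
      · exact Or.inl (max_le ((W.step b).bhat_le_of_tv _ hε.le ht (by linarith))
          ((W.step b).bhat_le_of_tv (x := ε ^ 4 / 64) _ hε.le (by linarith) (by linarith)))
  · rcases ht with ht | ht
    · cases j
      · exact Or.inl (max_le ((W.step b).bhat_le_of_tv _ hε.le hf (by linarith))
          ((W.step b).bhat_le_of_tv (x := ε ^ 4 / 64) _ hε.le (by linarith) (by linarith)))
      · exact Or.inr (by simpa using by linarith)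
    · -- both `Z_1` and `Z_2` are small
      have hsq : 2 * (ε ^ 4 / 128) ≤ (ε ^ 2 / 8) ^ 2 := by nlinarith
      have z1 := (W.step b).bhat_le_of_tv _ (by positivity) hf hsq
      have z2 := (W.step b).bhat_le_of_tv _ (by positivity) ht hsq
      have z3 : (W.step b).bhat (1, 1) ≤ ε := by
        have q1 := W.bhat_le_one (0, 1)
        have q2 := W.bhat_le_one (1, 0)
        have q3 := W.bhat_le_one (1, 1)
        have p1 := W.bhat_nonneg (0, 1)
        have p2 := W.bhat_nonneg (1, 0)
        have p3 := W.bhat_nonneg (1, 1)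
        cases b with
        | true =>
          rw [step_true, bhat_good_two] at z2
          rw [step_true, bhat_good_three]
          have : W.bhat (0, 1) ≤ ε := le_of_sq_le_sq (by nlinarith) hε.le
          nlinarith
        | false =>
          rw [step_false] at hf ht ⊢
          have t1 := W.tv_le_one (0, 1)
          have t3 := W.tv_le_one (1, 1)
          have t1' := W.tv_nonneg (0, 1)
          have t3' := W.tv_nonneg (1, 1)
          have b2 := mul_le_mul_of_nonneg_left W.tvSnd_le_tv_three t1'
          rw [tv_bad_two] at ht
          -- `T_2` of the bad channel is at most `T_1 T_3`, so `T_1` and `T_3` are close to `1`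
          have c2 := W.bhat_le_of_tv (1, 0) (by positivity)
            (hf.trans W.tv_bad_one_le) hsq
          have c1 := W.bhat_le_of_tv (x := ε ^ 4 / 128) (0, 1) (by positivity)
            (by nlinarith) hsq
          have c3 := W.bhat_le_of_tv (x := ε ^ 4 / 128) (1, 1) (by positivity)
            (by nlinarith) hsq
          have := W.bhat_bad_three_le
          nlinarith
      cases j
      · exact Or.inl (max_le (by simpa using by linarith) z3)
      · exact Or.inl (max_le (by simpa using by linarith) z3)

open Classical in
/-- Polarization: the fraction of the virtual channels for which neither `U_j` nor `T_j` is small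
tends to `0`. -/
theorem tendsto_pathAvg_polarized {ε : ℝ} (hε : 0 < ε) (hε1 : ε ≤ 1) (j : Bool) :
    Filter.Tendsto (fun n => pathAvg n
      (fun V => if V.zMax j ≤ ε ∨ V.tvAxis j ≤ ε then (0 : ℝ) else 1) W)
      Filter.atTop (𝓝 0) := by
  rw [← Filter.tendsto_add_atTop_iff_nat 1]
  set η := ε ^ 4 / 128 with hη
  have hη0 : 0 < η := by positivity
  have hη1 : η ≤ 1 / 2 := by
    have : ε ^ 4 ≤ 1 := pow_le_one₀ hε.le hε1
    linarith
  set C := ((η / 2) ^ 2)⁻¹ with hC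
  have hC0 : 0 < C := by positivity
  have h := (((W.tendsto_pathAvg_unpol false).comp (Filter.tendsto_add_atTop_nat 1)).add
    ((W.tendsto_pathAvg_unpol true).comp (Filter.tendsto_add_atTop_nat 1))).const_mul C
  rw [add_zero, mul_zero] at h
  refine squeeze_zero (fun n => pathAvg_nonneg (fun V => ?_) _ W) (fun n => ?_) h
  · split_ifs <;> norm_num
  have key : ∀ (V : Chan.{u}) (b : Bool),
      (if (V.step b).zMax j ≤ ε ∨ (V.step b).tvAxis j ≤ ε then (0 : ℝ) else 1) ≤
        C * ((V.step b).unpol false + (V.step b).unpol true) := by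
    intro V b
    have n1 := (V.step b).unpol_nonneg false
    have n2 := (V.step b).unpol_nonneg true
    split_ifs with hc
    · positivity
    · have hx : ∃ k, η < (V.step b).tvAxis k ∧ (V.step b).tvAxis k < 1 - η := by
        by_contra hcon
        push Not at hcon
        refine hc (V.polarized_step hε hε1 b (fun k => ?_) j)
        rcases le_or_gt ((V.step b).tvAxis k) η with h1 | h1
        · exact Or.inl h1
        · exact Or.inr (hcon k h1)
      obtain ⟨k, h1, h2⟩ := hx
      have h3 : (η / 2) ^ 2 ≤ (V.step b).unpol k := by
        refine pow_le_pow_left₀ (by positivity) ?_ 2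
        nlinarith
      have h4 : (V.step b).unpol k ≤ (V.step b).unpol false + (V.step b).unpol true := by
        cases k <;> linarith
      rw [hC, inv_mul_eq_div, le_div_iff₀ (by positivity), one_mul]
      exact h3.trans h4
  simp only [Function.comp]
  rw [← pathAvg_add_fun, ← pathAvg_mul, pathAvg_succ, pathAvg_succ]
  refine pathAvg_mono (fun V => ?_) n W
  exact div_le_div_of_nonneg_right (add_le_add (key V false) (key V true)) zero_le_two

end Chan

/-! ### Speed of polarization -/

/-- The constants of the exponential estimate. The exponent `s` is so small that the average of
`L ^ (-s)` shrinks at the rate `ρ` per step, with `ρ < 2 ^ (-β s)`; the constant `c` absorbs the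
loss `L ↦ L - 2`, and `κ` is the weight of the states in which no squaring is possible. -/
theorem exists_rate {β : ℝ} (h0 : 0 < β) (h1 : β < 1 / 4) :
    ∃ s ρ κ c : ℝ, 0 < s ∧ 0 < ρ ∧ ρ < 1 ∧ 1 ≤ κ ∧ 1 < c ∧ c ≤ ρ * κ ∧
      κ * ((2 : ℝ) ^ (-s) + c) / 2 ≤ ρ ∧ ρ * (2 : ℝ) ^ (β * s) < 1 := by
  obtain ⟨γ, hγ1, hγ2⟩ : ∃ γ, β < γ ∧ γ < 1 / 4 := exists_between h1
  have hγ0 : 0 < γ := h0.trans hγ1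
  -- `t = 1 - x` is to be `2 ^ (-s)`: near `t = 1`, the slope `2 γ` of `t ^ (2 γ)` is smaller than
  -- the slope `1 / 2` of `(1 + t) / 2`
  set x := 1 / 2 - 2 * γ with hx
  have hx0 : 0 < x := by linarith
  have hx1 : x < 1 / 2 := by linarith
  set t := 1 - x with ht
  have ht0 : 0 < t := by linarith
  have ht1 : t < 1 := by linarith
  have hpow : (1 + t) / 2 < t ^ (2 * γ) := by
    have hB := rpow_one_add_le_one_add_mul_self (s := x / t) (p := 2 * γ)
      (by have : 0 < x / t := by positivity
          linarith) (by linarith) (by linarith)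
    have h2 : 1 + x / t = t⁻¹ := by
      field_simp
      linarith
    rw [h2, Real.inv_rpow ht0.le] at hB
    have hp : 0 < t ^ (2 * γ) := Real.rpow_pos_of_pos ht0 _
    have h3 : (1 + t) / 2 * (1 + 2 * γ * (x / t)) < 1 := by
      rw [show 1 + 2 * γ * (x / t) = (t + 2 * γ * x) / t by field_simp, mul_div_assoc',
        div_lt_one ht0]
      have : 2 * γ = 1 / 2 - x := by linarith
      rw [this, ht]
      nlinarith [mul_pos hx0 hx0, mul_pos (mul_pos hx0 hx0) hx0]
    have h4 : (1 + t) / 2 * (t ^ (2 * γ))⁻¹ < 1 :=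
      lt_of_le_of_lt (mul_le_mul_of_nonneg_left hB (by linarith)) h3
    rwa [mul_inv_lt_iff₀ hp, one_mul] at h4
  obtain ⟨c, hc1, hc⟩ : ∃ c, 1 < c ∧ c * (t + c) / 2 < t ^ (2 * γ) := by
    have hcont : Continuous fun c : ℝ => c * (t + c) / 2 := by fun_prop
    have h5 : ∀ᶠ c in 𝓝 (1 : ℝ), c * (t + c) / 2 < t ^ (2 * γ) :=
      hcont.continuousAt.eventually_lt continuousAt_const (by simpa [add_comm] using hpow)
    have h6 : ∃ᶠ c in 𝓝[>] (1 : ℝ), 1 < c := by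
      exact (eventually_mem_nhdsWithin (s := Set.Ioi (1 : ℝ))).frequently
    obtain ⟨c, h7, h8⟩ := (h6.and_eventually (h5.filter_mono nhdsWithin_le_nhds)).exists
    exact ⟨c, h7, h8⟩
  set s := -Real.logb 2 t with hs
  have hs0 : 0 < s := by
    have := Real.logb_neg (b := 2) (by norm_num) ht0 ht1
    linarith
  have h2s : (2 : ℝ) ^ (-s) = t := by
    rw [hs, neg_neg, Real.rpow_logb (by norm_num) (by norm_num) ht0]
  have hρ0 : 0 < t ^ γ := Real.rpow_pos_of_pos ht0 _
  have hρ1 : t ^ γ < 1 := Real.rpow_lt_one ht0.le ht1 hγ0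
  have hρ2 : t ^ γ * t ^ γ = t ^ (2 * γ) := by rw [← Real.rpow_add ht0]; ring_nf
  refine ⟨s, t ^ γ, c / t ^ γ, c, hs0, hρ0, hρ1, ?_, hc1, ?_, ?_, ?_⟩
  · rw [one_le_div hρ0]
    linarith
  · rw [mul_div_cancel₀ _ hρ0.ne']
  · rw [h2s, div_mul_eq_mul_div, div_div, div_le_iff₀ (by positivity)]
    nlinarith
  · have : (2 : ℝ) ^ (β * s) = t ^ (-β) := by
      rw [← h2s, ← Real.rpow_mul (by norm_num)]
      ring_nf
    rw [this, ← Real.rpow_add ht0]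
    exact Real.rpow_lt_one ht0.le ht1 (by linarith)

namespace Chan

variable (W : Chan.{u})

open Classical in
/-- If `X σ ≤ 2 ^ (-L)` at the start, then this bounds the fraction of the virtual channels with
`k` steps for which the parameter is not below `2 ^ (-θ)`. The potential `L ^ (-s)` shrinks on
average as long as `L ≥ Λ`; the first summand accounts for the paths on which `L` drops below `Λ`.
The index alternates, so `not^[k] σ` is the one reached after `k` steps. -/
theorem pathAvg_squaredBy_le {X : Bool → Chan.{u} → ℝ} {g : Bool} (hX : SquaredBy X g)
    {s ρ κ c Λ θ : ℝ} (hs : 0 < s) (hρ0 : 0 < ρ) (hρ1 : ρ < 1) (hκ : 1 ≤ κ)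
    (hcκ : c ≤ ρ * κ) (hcρ : κ * ((2 : ℝ) ^ (-s) + c) / 2 ≤ ρ)
    (hΛ2 : 2 < Λ) (hΛ : ∀ L, Λ ≤ L → (L - 2) ^ (-s) ≤ c * L ^ (-s)) (hθ : 0 < θ)
    (k : ℕ) (σ : Bool) (L : ℝ) (hL : 0 < L) (W : Chan.{u}) (hW : X σ W ≤ (2 : ℝ) ^ (-L)) :
    pathAvg k (fun V => if X (not^[k] σ) V ≤ (2 : ℝ) ^ (-θ) then (0 : ℝ) else 1) W ≤
      (if σ then κ else 1) * ((Λ ^ s + ρ ^ k * θ ^ s) * L ^ (-s)) := by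
  induction k generalizing σ L W with
  | zero =>
    have hκ' : 1 ≤ if σ then κ else 1 := by split_ifs <;> linarith
    have hpos : 0 ≤ (Λ ^ s + ρ ^ 0 * θ ^ s) * L ^ (-s) := by positivity
    change (if X σ W ≤ (2 : ℝ) ^ (-θ) then (0 : ℝ) else 1) ≤ _
    by_cases h : X σ W ≤ (2 : ℝ) ^ (-θ)
    · rw [if_pos h]
      exact mul_nonneg (by linarith) hpos
    · rw [if_neg h]
      have hLθ : L ≤ θ := by
        by_contra hlt
        push Not at hlt
        exact h (hW.trans (Real.rpow_le_rpow_of_exponent_le (by norm_num) (by linarith)))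
      have h1 : 1 ≤ θ ^ s * L ^ (-s) := by
        rw [Real.rpow_neg hL.le, ← div_eq_mul_inv, one_le_div (Real.rpow_pos_of_pos hL _)]
        exact Real.rpow_le_rpow hL.le hLθ hs.le
      have h2 : 0 ≤ Λ ^ s * L ^ (-s) := by positivity
      rw [pow_zero, one_mul, add_mul]
      nlinarith
  | succ k ih =>
    have hκ' : 1 ≤ if σ then κ else 1 := by split_ifs <;> linarith
    rcases lt_or_ge L Λ with hLΛ | hLΛ
    -- below `Λ` the claimed bound exceeds `1`
    · have h1 : 1 ≤ Λ ^ s * L ^ (-s) := by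
        rw [Real.rpow_neg hL.le, ← div_eq_mul_inv, one_le_div (Real.rpow_pos_of_pos hL _)]
        exact Real.rpow_le_rpow hL.le hLΛ.le hs.le
      have h2 : 0 ≤ ρ ^ (k + 1) * θ ^ s * L ^ (-s) := by positivity
      have h3 := pathAvg_mono
        (g := fun V => if X (not^[k + 1] σ) V ≤ (2 : ℝ) ^ (-θ) then (0 : ℝ) else 1)
        (g' := fun _ => 1) (fun V => by split_ifs <;> norm_num) (k + 1) W
      rw [pathAvg_const] at h3
      refine h3.trans ?_
      rw [add_mul]
      nlinarith
    · have hL2 : 0 < L - 2 := by linarith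
      have hstep : ∀ b, X (!σ) (W.step b) ≤ (2 : ℝ) ^ (-(L - 2)) := by
        intro b
        have h := hX.step_le (!σ) W b
        rw [Bool.not_not] at h
        have h4 : (2 : ℝ) ^ (-(L - 2)) = 4 * (2 : ℝ) ^ (-L) := by
          rw [neg_sub, sub_eq_add_neg, Real.rpow_add (by norm_num)]
          norm_num
        rw [h4]
        linarith
      have hbase : 0 ≤ Λ ^ s + ρ ^ k * θ ^ s := by positivity
      have hbase' : ρ * (Λ ^ s + ρ ^ k * θ ^ s) ≤ Λ ^ s + ρ ^ (k + 1) * θ ^ s := by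
        have : 0 ≤ Λ ^ s := by positivity
        rw [pow_succ]
        nlinarith
      have hLs : 0 ≤ L ^ (-s) := by positivity
      have hΛL := hΛ L hLΛ
      simp only [Function.iterate_succ_apply, pathAvg]
      cases σ with
      | true =>
        have i0 := ih false (L - 2) hL2 W.bad (hstep false)
        have i1 := ih false (L - 2) hL2 W.good (hstep true)
        simp only [Bool.not_true, if_true, if_false, Bool.false_eq_true, one_mul] at i0 i1 ⊢
        calc _ ≤ (Λ ^ s + ρ ^ k * θ ^ s) * (L - 2) ^ (-s) := by linarith
          _ ≤ (Λ ^ s + ρ ^ k * θ ^ s) * (ρ * κ * L ^ (-s)) :=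
            mul_le_mul_of_nonneg_left
              (hΛL.trans (mul_le_mul_of_nonneg_right hcκ hLs)) hbase
          _ = κ * (ρ * (Λ ^ s + ρ ^ k * θ ^ s) * L ^ (-s)) := by ring
          _ ≤ _ := mul_le_mul_of_nonneg_left
            (mul_le_mul_of_nonneg_right hbase' hLs) (by linarith)
      | false =>
        have hsq : X true (W.step g) ≤ (2 : ℝ) ^ (-(2 * L)) := by
          refine (hX.step_sq W).trans ?_
          rw [show -(2 * L) = -L + -L by ring, Real.rpow_add (by norm_num), ← sq]
          exact pow_le_pow_left₀ (hX.nonneg _ _) hW 2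
        have i0 := ih true (L - 2) hL2 (W.step (!g)) (hstep (!g))
        have i1 := ih true (2 * L) (by linarith) (W.step g) hsq
        rw [Real.mul_rpow (by norm_num) hL.le] at i1
        have hsum : ∀ F : Chan.{u} → ℝ, F W.bad + F W.good = F (W.step (!g)) + F (W.step g) := by
          intro F
          cases g
          · exact add_comm _ _
          · rfl
        rw [hsum (pathAvg k _)]
        simp only [Bool.not_false, if_true, if_false, Bool.false_eq_true, one_mul] at i0 i1 ⊢
        calc _ ≤ (κ * ((Λ ^ s + ρ ^ k * θ ^ s) * (L - 2) ^ (-s)) +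
              κ * ((Λ ^ s + ρ ^ k * θ ^ s) * ((2 : ℝ) ^ (-s) * L ^ (-s)))) / 2 := by
              linarith
          _ ≤ (κ * ((Λ ^ s + ρ ^ k * θ ^ s) * (c * L ^ (-s))) +
              κ * ((Λ ^ s + ρ ^ k * θ ^ s) * ((2 : ℝ) ^ (-s) * L ^ (-s)))) / 2 := by
              gcongr
          _ = κ * ((2 : ℝ) ^ (-s) + c) / 2 * ((Λ ^ s + ρ ^ k * θ ^ s) * L ^ (-s)) := by ring
          _ ≤ ρ * ((Λ ^ s + ρ ^ k * θ ^ s) * L ^ (-s)) :=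
            mul_le_mul_of_nonneg_right hcρ (by positivity)
          _ = (ρ * (Λ ^ s + ρ ^ k * θ ^ s)) * L ^ (-s) := by ring
          _ ≤ _ := mul_le_mul_of_nonneg_right hbase' hLs

theorem exists_threshold {s c : ℝ} (hc : 1 < c) :
    ∃ Λ : ℝ, 2 < Λ ∧ ∀ L, Λ ≤ L → (L - 2) ^ (-s) ≤ c * L ^ (-s) := by
  have h1 : Filter.Tendsto (fun L : ℝ => (1 - 2 / L) ^ (-s)) Filter.atTop (𝓝 1) := by
    have h2 : Filter.Tendsto (fun L : ℝ => 1 - 2 / L) Filter.atTop (𝓝 1) := by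
      simpa using tendsto_const_nhds.sub
        ((tendsto_const_nhds (x := (2 : ℝ))).div_atTop Filter.tendsto_id)
    simpa using h2.rpow_const (p := -s) (Or.inl one_ne_zero)
  obtain ⟨Λ, hΛ⟩ := Filter.eventually_atTop.1 (h1.eventually_le_const hc)
  refine ⟨max Λ 3, lt_max_of_lt_right (by norm_num), fun L hL => ?_⟩
  have hL3 : 3 ≤ L := (le_max_right _ _).trans hL
  have hL0 : 0 < L := by linarith
  have h3 : 0 ≤ 1 - 2 / L := by
    rw [sub_nonneg, div_le_one hL0]
    linarith
  rw [show L - 2 = (1 - 2 / L) * L by field_simp, Real.mul_rpow h3 hL0.le]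
  exact mul_le_mul_of_nonneg_right (hΛ L ((le_max_left _ _).trans hL)) (by positivity)

open Classical in
/-- Fast polarization: the thresholds of `tendsto_pathAvg_polarized` may decrease like
`2 ^ (-2 ^ (β n))`. -/
theorem tendsto_pathAvg_fast {β : ℝ} (h0 : 0 < β) (h1 : β < 1 / 4) (j : Bool) :
    Filter.Tendsto (fun n : ℕ => pathAvg n
      (fun V => if V.zMax j ≤ (2 : ℝ) ^ (-(2 + (2 : ℝ) ^ (β * (n : ℝ)))) ∨
        V.tvAxis j ≤ (2 : ℝ) ^ (-(2 + (2 : ℝ) ^ (β * (n : ℝ)))) then (0 : ℝ) else 1) W)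
      Filter.atTop (𝓝 0) := by
  obtain ⟨s, ρ, κ, c, hs, hρ0, hρ1, hκ, hc, hcκ, hcρ, hβ⟩ := exists_rate h0 h1
  obtain ⟨Λ, hΛ2, hΛ⟩ := exists_threshold (s := s) hc
  have hκ0 : 0 < κ := by linarith
  rw [Metric.tendsto_atTop]
  intro η hη
  -- the initial exponent `L`
  obtain ⟨L, hL0, hL⟩ : ∃ L : ℝ, 0 < L ∧ κ * (Λ ^ s * L ^ (-s)) < η / 3 := by
    have h2 : Filter.Tendsto (fun L : ℝ => κ * (Λ ^ s * L ^ (-s))) Filter.atTop (𝓝 0) := by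
      simpa using ((tendsto_rpow_neg_atTop hs).const_mul (Λ ^ s)).const_mul κ
    obtain ⟨L, h3, h4⟩ := ((h2.eventually_lt_const (by positivity : (0 : ℝ) < η / 3)).and
      (Filter.eventually_gt_atTop 0)).exists
    exact ⟨L, h4, h3⟩
  have hε : (0 : ℝ) < (2 : ℝ) ^ (-L) := by positivity
  have hε1 : (2 : ℝ) ^ (-L) ≤ 1 := Real.rpow_le_one_of_one_le_of_nonpos (by norm_num) (by linarith)
  -- the number `m` of initial steps after which polarization to `2 ^ (-L)` has taken place
  obtain ⟨m, hm⟩ : ∃ m : ℕ, ∀ i, pathAvg m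
      (fun V => if V.zMax i ≤ (2 : ℝ) ^ (-L) ∨ V.tvAxis i ≤ (2 : ℝ) ^ (-L) then (0 : ℝ) else 1) W
        < η / 3 := by
    have h5 := fun i => (W.tendsto_pathAvg_polarized hε hε1 i).eventually_lt_const
      (by positivity : (0 : ℝ) < η / 3)
    obtain ⟨m, h6, h7⟩ := ((h5 false).and (h5 true)).exists
    exact ⟨m, fun i => by cases i <;> assumption⟩
  -- the remaining steps
  have hlim : Filter.Tendsto (fun k : ℕ => κ * (ρ ^ k *
      (2 + (2 : ℝ) ^ (β * ((m + k : ℕ) : ℝ))) ^ s * L ^ (-s))) Filter.atTop (𝓝 0) := by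
    have h8 : Filter.Tendsto (fun k : ℕ => κ * ((ρ * (2 : ℝ) ^ (β * s)) ^ k *
        (3 * (2 : ℝ) ^ (β * (m : ℝ))) ^ s * L ^ (-s))) Filter.atTop (𝓝 0) := by
      simpa using (((tendsto_pow_atTop_nhds_zero_of_lt_one (by positivity) hβ).mul_const
        ((3 * (2 : ℝ) ^ (β * (m : ℝ))) ^ s)).mul_const (L ^ (-s))).const_mul κ
    refine squeeze_zero (fun k => by positivity) (fun k => ?_) h8
    have h9 : (2 + (2 : ℝ) ^ (β * ((m + k : ℕ) : ℝ))) ^ s ≤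
        (3 * (2 : ℝ) ^ (β * (m : ℝ))) ^ s * ((2 : ℝ) ^ (β * s)) ^ k := by
      have h10 : ((2 : ℝ) ^ (β * s)) ^ k = ((2 : ℝ) ^ (β * (k : ℝ))) ^ s := by
        rw [← Real.rpow_natCast, ← Real.rpow_mul (by norm_num), ← Real.rpow_mul (by norm_num)]
        ring_nf
      rw [h10, ← Real.mul_rpow (by positivity) (by positivity), mul_assoc,
        ← Real.rpow_add (by norm_num), ← mul_add, ← Nat.cast_add]
      refine Real.rpow_le_rpow (by positivity) ?_ hs.le
      have : 1 ≤ (2 : ℝ) ^ (β * ((m + k : ℕ) : ℝ)) :=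
        Real.one_le_rpow (by norm_num) (by positivity)
      linarith
    calc _ ≤ κ * (ρ ^ k * ((3 * (2 : ℝ) ^ (β * (m : ℝ))) ^ s * ((2 : ℝ) ^ (β * s)) ^ k) *
          L ^ (-s)) := by gcongr
      _ = _ := by rw [mul_pow]; ring
  obtain ⟨K, hK⟩ := Filter.eventually_atTop.1
    (hlim.eventually_lt_const (by positivity : (0 : ℝ) < η / 3))
  refine ⟨m + K, fun n hn => ?_⟩
  obtain ⟨k, rfl⟩ : ∃ k, n = m + k := ⟨n - m, by omega⟩
  set θ := 2 + (2 : ℝ) ^ (β * ((m + k : ℕ) : ℝ)) with hθ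
  have hθ0 : 0 < θ := by positivity
  have hnn : 0 ≤ pathAvg (m + k) (fun V => if V.zMax j ≤ (2 : ℝ) ^ (-θ) ∨
      V.tvAxis j ≤ (2 : ℝ) ^ (-θ) then (0 : ℝ) else 1) W :=
    pathAvg_nonneg (fun V => by split_ifs <;> norm_num) _ _
  rw [Real.dist_eq, sub_zero, abs_of_nonneg hnn, pathAvg_add]
  have hKk := hK k (by omega)
  -- the index at the first `m` steps whose parameters become those of index `j`
  set i := not^[k] j with hi
  have hij : not^[k] i = j := by
    rw [hi, ← Function.iterate_add_apply, ← two_mul, Function.iterate_mul]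
    have : (not^[2] : Bool → Bool) = id := by funext b; simp
    rw [this, Function.iterate_id, id]
  have hκi : (if i then κ else 1) ≤ κ := by split_ifs <;> linarith
  have hvalue : 0 ≤ (Λ ^ s + ρ ^ k * θ ^ s) * L ^ (-s) := by positivity
  have hpt : ∀ V : Chan.{u}, pathAvg k (fun V => if V.zMax j ≤ (2 : ℝ) ^ (-θ) ∨
      V.tvAxis j ≤ (2 : ℝ) ^ (-θ) then (0 : ℝ) else 1) V ≤
      (if V.zMax i ≤ (2 : ℝ) ^ (-L) ∨ V.tvAxis i ≤ (2 : ℝ) ^ (-L) then (0 : ℝ) else 1) +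
        κ * ((Λ ^ s + ρ ^ k * θ ^ s) * L ^ (-s)) := by
    intro V
    by_cases hV : V.zMax i ≤ (2 : ℝ) ^ (-L) ∨ V.tvAxis i ≤ (2 : ℝ) ^ (-L)
    · rw [if_pos hV, zero_add]
      refine le_trans ?_ (mul_le_mul_of_nonneg_right hκi hvalue)
      rcases hV with hV | hV
      · have h := pathAvg_squaredBy_le squaredBy_zMax hs hρ0 hρ1 hκ hcκ hcρ hΛ2 hΛ hθ0 k i L
          hL0 V hV
        rw [hij] at h
        refine (pathAvg_mono (fun V => ?_) k V).trans h
        by_cases hz : V.zMax j ≤ (2 : ℝ) ^ (-θ)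
        · rw [if_pos (Or.inl hz), if_pos hz]
        · rw [if_neg hz]
          split_ifs <;> norm_num
      · have h := pathAvg_squaredBy_le squaredBy_tvAxis hs hρ0 hρ1 hκ hcκ hcρ hΛ2 hΛ hθ0 k i L
          hL0 V hV
        rw [hij] at h
        refine (pathAvg_mono (fun V => ?_) k V).trans h
        by_cases hz : V.tvAxis j ≤ (2 : ℝ) ^ (-θ)
        · rw [if_pos (Or.inr hz), if_pos hz]
        · rw [if_neg hz]
          split_ifs <;> norm_num
    · rw [if_neg hV]
      have h := pathAvg_mono (g := fun V => if V.zMax j ≤ (2 : ℝ) ^ (-θ) ∨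
        V.tvAxis j ≤ (2 : ℝ) ^ (-θ) then (0 : ℝ) else 1) (g' := fun _ => 1)
        (fun V => by split_ifs <;> norm_num) k V
      rw [pathAvg_const] at h
      have := mul_nonneg hκ0.le hvalue
      linarith
  have h := pathAvg_mono hpt m W
  rw [pathAvg_add_fun, pathAvg_const] at h
  have hmi := hm i
  have : κ * ((Λ ^ s + ρ ^ k * θ ^ s) * L ^ (-s)) =
      κ * (Λ ^ s * L ^ (-s)) + κ * (ρ ^ k * θ ^ s * L ^ (-s)) := by ring
  linarith

end Chan

/-! ### The polar transform along the first bit -/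

/-- Families indexed by bit strings, split according to the first bit. -/
def splitEquiv (n : ℕ) (A : Type*) :
    ((Fin (n + 1) → Bool) → A) ≃ ((Fin n → Bool) → A) × ((Fin n → Bool) → A) where
  toFun e := (fun t => e (Fin.cons false t), fun t => e (Fin.cons true t))
  invFun p j := if j 0 then p.2 (Fin.tail j) else p.1 (Fin.tail j)
  left_inv e := by
    funext j
    rw [← Fin.cons_self_tail j]
    cases j 0 <;> simp
  right_inv p := by simp

theorem splitEquiv_symm_false {n : ℕ} {A : Type*}
    (p : ((Fin n → Bool) → A) × ((Fin n → Bool) → A)) (t : Fin n → Bool) :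
    (splitEquiv n A).symm p (Fin.cons false t) = p.1 t := by
  simp [splitEquiv]

theorem splitEquiv_symm_true {n : ℕ} {A : Type*}
    (p : ((Fin n → Bool) → A) × ((Fin n → Bool) → A)) (t : Fin n → Bool) :
    (splitEquiv n A).symm p (Fin.cons true t) = p.2 t := by
  simp [splitEquiv]

theorem prod_cons {n : ℕ} (f : (Fin (n + 1) → Bool) → ℝ) :
    ∏ k, f k = (∏ t : Fin n → Bool, f (Fin.cons false t)) *
      ∏ t : Fin n → Bool, f (Fin.cons true t) := by
  rw [← Equiv.prod_comp (Fin.consEquiv fun _ => Bool), Fintype.prod_prod_type, Fintype.prod_bool,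
    mul_comm]
  rfl

theorem forall_cons {n : ℕ} {p : (Fin (n + 1) → Bool) → Prop} :
    (∀ j, p j) ↔ (∀ t : Fin n → Bool, p (Fin.cons false t)) ∧
      ∀ t : Fin n → Bool, p (Fin.cons true t) := by
  refine ⟨fun h => ⟨fun t => h _, fun t => h _⟩, fun h j => ?_⟩
  rw [← Fin.cons_self_tail j]
  cases j 0
  · exact h.1 _
  · exact h.2 _

theorem toLex_cons_lt {n : ℕ} (b c : Bool) (j i : Fin n → Bool) :
    toLex (Fin.cons b j : Fin (n + 1) → Bool) < toLex (Fin.cons c i : Fin (n + 1) → Bool) ↔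
      b < c ∨ b = c ∧ toLex j < toLex i :=
  Fin.pi_lex_lt_cons_cons (α := fun _ => Bool) (fun {_} x y => x < y)

theorem polarTransform_add (n : ℕ) (e e' : (Fin n → Bool) → Pauli) :
    polarTransform n (e + e') = polarTransform n e + polarTransform n e' := by
  induction n with
  | zero => rfl
  | succ n ih =>
    funext j
    have h0 := ih (fun t => e (Fin.cons false t)) (fun t => e' (Fin.cons false t))
    have h1 := ih (fun t => e (Fin.cons true t)) (fun t => e' (Fin.cons true t))
    simp only [polarTransform, Pi.add_apply]
    have h0' : (fun t => e (Fin.cons false t) + e' (Fin.cons false t)) =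
        (fun t => e (Fin.cons false t)) + fun t => e' (Fin.cons false t) := rfl
    have h1' : (fun t => e (Fin.cons true t) + e' (Fin.cons true t)) =
        (fun t => e (Fin.cons true t)) + fun t => e' (Fin.cons true t) := rfl
    rw [h0', h1', h0, h1]
    have h2 := gammaL_add
      (polarTransform n (fun t => e (Fin.cons false t)) (Fin.tail j),
        polarTransform n (fun t => e (Fin.cons true t)) (Fin.tail j))
      (polarTransform n (fun t => e' (Fin.cons false t)) (Fin.tail j),
        polarTransform n (fun t => e' (Fin.cons true t)) (Fin.tail j))
    rw [Prod.mk_add_mk] at h2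
    simp only [Pi.add_apply, h2]
    split_ifs <;> rfl

/-- Summing a product over all values of the polar transform of a uniformly random input. -/
theorem sum_prod_polarTransform {n : ℕ} (f : (Fin n → Bool) → Pauli → ℝ) :
    ∑ e, ∏ k, f k (polarTransform n e k) = ∏ k, ∑ v, f k v := by
  rw [Finset.prod_univ_sum, Fintype.piFinset_univ]
  exact Equiv.sum_comp (polarPerm n) fun b => ∏ k, f k (b k)

open Classical in
/-- The indicator of a proposition. -/
def ind (p : Prop) : ℝ := if p then 1 else 0

theorem ind_true {p : Prop} (h : p) : ind p = 1 := if_pos h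

theorem ind_false {p : Prop} (h : ¬p) : ind p = 0 := if_neg h

theorem ind_nonneg (p : Prop) : 0 ≤ ind p := by
  unfold ind
  split_ifs <;> norm_num

theorem ind_and (p q : Prop) : ind (p ∧ q) = ind p * ind q := by
  by_cases hp : p <;> by_cases hq : q <;> simp [ind, hp, hq]

theorem sum_ind_mul {ι : Type*} [Fintype ι] (a : ι) (f : ι → ℝ) :
    ∑ x, ind (x = a) * f x = f a := by
  classical
  rw [Finset.sum_eq_single a (fun b _ hb => by rw [ind_false hb, zero_mul])
    (fun h => absurd (Finset.mem_univ a) h), ind_true rfl, one_mul]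

/-- The values at the positions before `i` coincide. -/
def Agrees {n : ℕ} (i : Fin n → Bool) (e a : (Fin n → Bool) → Pauli) : Prop :=
  ∀ j, toLex j < toLex i → e j = a j

theorem agrees_cons_false {n : ℕ} (i : Fin n → Bool) (e a : (Fin (n + 1) → Bool) → Pauli) :
    Agrees (Fin.cons false i) e a ↔
      Agrees i (fun t => e (Fin.cons false t)) (fun t => a (Fin.cons false t)) := by
  unfold Agrees
  rw [forall_cons]
  simp [toLex_cons_lt]

theorem agrees_cons_true {n : ℕ} (i : Fin n → Bool) (e a : (Fin (n + 1) → Bool) → Pauli) :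
    Agrees (Fin.cons true i) e a ↔
      (fun t => e (Fin.cons false t)) = (fun t => a (Fin.cons false t)) ∧
      Agrees i (fun t => e (Fin.cons true t)) (fun t => a (Fin.cons true t)) := by
  unfold Agrees
  rw [forall_cons]
  simp [toLex_cons_lt, funext_iff]

theorem agrees_zero (i : Fin 0 → Bool) (e a : (Fin 0 → Bool) → Pauli) : Agrees i e a := by
  intro j hj
  rw [Subsingleton.elim j i] at hj
  exact absurd hj (lt_irrefl _)

/-- The number of families of values that agree with a given one before `i`: the multiplicity with
which a sum over all families counts the values before `i`. -/
def extCount (n : ℕ) (i : Fin n → Bool) : ℝ := ∑ a, ind (Agrees i 0 a)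

theorem sum_agrees {n : ℕ} (i : Fin n → Bool) (e : (Fin n → Bool) → Pauli) :
    ∑ a : (Fin n → Bool) → Pauli, ind (Agrees i e a) = extCount n i := by
  have h : ∀ a, Agrees i e (a + e) ↔ Agrees i 0 a := fun a =>
    forall_congr' fun j => imp_congr_right fun _ => by simp [eq_comm]
  rw [← Equiv.sum_comp (Equiv.addRight e)]
  simp only [Equiv.coe_addRight, h]
  rfl

theorem extCount_pos (n : ℕ) (i : Fin n → Bool) : 0 < extCount n i :=
  Finset.sum_pos' (fun _ _ => ind_nonneg _)
    ⟨0, Finset.mem_univ _, by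
      rw [ind_true (show Agrees i 0 0 from fun _ _ => rfl)]; exact zero_lt_one⟩

theorem sum_split {n : ℕ} {A : Type*} [Fintype A] (f : ((Fin (n + 1) → Bool) → A) → ℝ) :
    ∑ y, f y = ∑ p : (Fin n → Bool) → A, ∑ q : (Fin n → Bool) → A,
      f ((splitEquiv n A).symm (p, q)) := by
  rw [← Fintype.sum_prod_type' (f := fun p q => f ((splitEquiv n A).symm (p, q)))]
  exact (Equiv.sum_comp (splitEquiv n A).symm f).symm

theorem extCount_cons_false (n : ℕ) (i : Fin n → Bool) :
    extCount (n + 1) (Fin.cons false i) = extCount n i * 4 ^ 2 ^ n := by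
  unfold extCount
  simp only [sum_split, agrees_cons_false, splitEquiv_symm_false, Finset.sum_const,
    Finset.card_univ, nsmul_eq_mul, ← Finset.mul_sum]
  rw [mul_comm]
  congr 1
  simp

theorem extCount_cons_true (n : ℕ) (i : Fin n → Bool) :
    extCount (n + 1) (Fin.cons true i) = extCount n i := by
  unfold extCount
  have h : ∀ p : (Fin n → Bool) → Pauli,
      ((fun t => (0 : (Fin (n + 1) → Bool) → Pauli) (Fin.cons false t)) = fun t => p t) ↔
        p = 0 := fun p => eq_comm
  simp only [sum_split, agrees_cons_true, splitEquiv_symm_false, splitEquiv_symm_true, ind_and,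
    h, ← Finset.mul_sum]
  exact sum_ind_mul 0 fun _ : (Fin n → Bool) → Pauli => ∑ q, ind (Agrees i 0 q)

theorem extCount_zero (i : Fin 0 → Bool) : extCount 0 i = 4 := by
  have h := sum_agrees i 0
  simp only [ind_true (agrees_zero i 0 _)] at h
  rw [← h]
  simp

theorem sum_arrow_prod {ι A B : Type*} [Fintype ι] [DecidableEq ι] [Fintype A] [Fintype B]
    (f : (ι → A × B) → ℝ) :
    ∑ y, f y = ∑ p : ι → A, ∑ q : ι → B, f fun k => (p k, q k) := by
  rw [← Fintype.sum_prod_type' (f := fun (p : ι → A) (q : ι → B) => f fun k => (p k, q k))]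
  exact (Equiv.sum_comp (Equiv.arrowProdEquivProdArrow ι (fun _ => A) (fun _ => B)).symm f).symm

theorem sqrt_mul_mul_mul {c x y : ℝ} (hc : 0 ≤ c) :
    Real.sqrt (c * x * (c * y)) = c * Real.sqrt (x * y) := by
  rw [mul_mul_mul_comm, Real.sqrt_mul (by positivity), Real.sqrt_mul_self hc]

namespace Chan

variable (V : Chan.{u})

/-- A pair of outputs of `V` as an output of the bad channel. -/
def badOut : V.Out × V.Out ≃ V.bad.Out := Equiv.refl _

/-- A first input and a pair of outputs of `V` as an output of the good channel. -/
def goodOut : Pauli × (V.Out × V.Out) ≃ V.good.Out := Equiv.refl _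

theorem bad_prob (y : V.Out × V.Out) (a : Pauli) :
    V.bad.prob (V.badOut y) a = ∑ v : Pauli, 1 / 4 * V.combine y.1 y.2 a v := rfl

theorem good_prob (y : Pauli × (V.Out × V.Out)) (v : Pauli) :
    V.good.prob (V.goodOut y) v = 1 / 4 * V.combine y.2.1 y.2.2 y.1 v := rfl

/-- The probability that the copies of `V` output `y` when the input of the encoding circuit is
`e`. -/
def pathProb (n : ℕ) (y : (Fin n → Bool) → V.Out) (e : (Fin n → Bool) → Pauli) : ℝ :=
  ∏ k, V.prob (y k) (polarTransform n e k)

/-- The likelihood at position `i`, for an arbitrary channel with input alphabet `Pauli`. -/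
def lik (n : ℕ) (y : (Fin n → Bool) → V.Out) (a : (Fin n → Bool) → Pauli) (i : Fin n → Bool)
    (v : Pauli) : ℝ :=
  ∑ e : (Fin n → Bool) → Pauli, ind (Agrees i e a) * (ind (e i = v) * V.pathProb n y e)

theorem pathProb_nonneg (n : ℕ) (y : (Fin n → Bool) → V.Out) (e : (Fin n → Bool) → Pauli) :
    0 ≤ V.pathProb n y e :=
  Finset.prod_nonneg fun _ _ => V.prob_nonneg _ _

theorem lik_nonneg (n : ℕ) (y : (Fin n → Bool) → V.Out) (a : (Fin n → Bool) → Pauli)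
    (i : Fin n → Bool) (v : Pauli) : 0 ≤ V.lik n y a i v :=
  Finset.sum_nonneg fun e _ =>
    mul_nonneg (ind_nonneg _) (mul_nonneg (ind_nonneg _) (V.pathProb_nonneg n y e))

theorem lik_congr {n : ℕ} (y : (Fin n → Bool) → V.Out) {a a' : (Fin n → Bool) → Pauli}
    {i : Fin n → Bool} (h : Agrees i a a') : V.lik n y a i = V.lik n y a' i := by
  have : ∀ e : (Fin n → Bool) → Pauli, Agrees i e a ↔ Agrees i e a' := fun e =>
    forall_congr' fun j => imp_congr_right fun hj => by rw [h j hj]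
  funext v
  simp only [lik, this]

theorem pathProb_succ (n : ℕ) (y : (Fin (n + 1) → Bool) → V.Out)
    (p q : (Fin n → Bool) → Pauli) :
    V.pathProb (n + 1) y ((splitEquiv n Pauli).symm (p, q)) =
      ∏ k, V.combine (y (Fin.cons false k)) (y (Fin.cons true k)) (polarTransform n p k)
        (polarTransform n q k) := by
  unfold pathProb combine
  rw [prod_cons, Finset.prod_mul_distrib]
  simp [polarTransform, splitEquiv_symm_false, splitEquiv_symm_true]

theorem prod_four (n : ℕ) : (4 : ℝ) ^ 2 ^ n = ∏ _k : Fin n → Bool, (4 : ℝ) := by simp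

/-- At a position of the first half, the inputs of the second half are uniformly random, which turns
pairs of copies of `V` into copies of the bad channel. -/
theorem lik_cons_false (n : ℕ) (y : (Fin (n + 1) → Bool) → V.Out)
    (a : (Fin (n + 1) → Bool) → Pauli) (i : Fin n → Bool) (v : Pauli) :
    V.lik (n + 1) y a (Fin.cons false i) v = 4 ^ 2 ^ n *
      V.bad.lik n (fun k => V.badOut (y (Fin.cons false k), y (Fin.cons true k)))
        (fun t => a (Fin.cons false t)) i v := by
  unfold lik
  rw [sum_split, Finset.mul_sum]
  refine Finset.sum_congr rfl fun e₀ _ => ?_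
  simp only [agrees_cons_false, splitEquiv_symm_false, pathProb_succ, ← Finset.mul_sum]
  rw [sum_prod_polarTransform (fun k w => V.combine (y (Fin.cons false k)) (y (Fin.cons true k))
    (polarTransform n e₀ k) w)]
  have h : (∏ k, ∑ w, V.combine (y (Fin.cons false k)) (y (Fin.cons true k))
      (polarTransform n e₀ k) w) = 4 ^ 2 ^ n *
      V.bad.pathProb n (fun k => V.badOut (y (Fin.cons false k), y (Fin.cons true k))) e₀ := by
    rw [prod_four, pathProb, ← Finset.prod_mul_distrib]
    refine Finset.prod_congr rfl fun k _ => ?_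
    rw [bad_prob, ← Finset.mul_sum]
    ring
  rw [h]
  ring

/-- At a position of the second half, the inputs of the first half are known, which turns pairs of
copies of `V` into copies of the good channel. -/
theorem lik_cons_true (n : ℕ) (y : (Fin (n + 1) → Bool) → V.Out)
    (a : (Fin (n + 1) → Bool) → Pauli) (i : Fin n → Bool) (v : Pauli) :
    V.lik (n + 1) y a (Fin.cons true i) v = 4 ^ 2 ^ n *
      V.good.lik n (fun k => V.goodOut (polarTransform n (fun t => a (Fin.cons false t)) k,
        (y (Fin.cons false k), y (Fin.cons true k)))) (fun t => a (Fin.cons true t)) i v := by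
  unfold lik
  rw [sum_split, Finset.sum_comm, Finset.mul_sum]
  refine Finset.sum_congr rfl fun e₁ _ => ?_
  simp only [agrees_cons_true, splitEquiv_symm_false, splitEquiv_symm_true, pathProb_succ,
    ind_and, mul_assoc]
  have h : (∏ k, V.combine (y (Fin.cons false k)) (y (Fin.cons true k))
      (polarTransform n (fun t => a (Fin.cons false t)) k) (polarTransform n e₁ k)) = 4 ^ 2 ^ n *
      V.good.pathProb n (fun k => V.goodOut (polarTransform n (fun t => a (Fin.cons false t)) k,
        (y (Fin.cons false k), y (Fin.cons true k)))) e₁ := by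
    rw [prod_four, pathProb, ← Finset.prod_mul_distrib]
    refine Finset.prod_congr rfl fun k _ => ?_
    rw [good_prob]
    ring
  rw [sum_ind_mul, h]
  ring

/-- The unnormalized contribution of the output `y` and the preceding values `a` to the
Bhattacharyya parameter `Z_d` at position `i`. -/
def sqrtSum (n : ℕ) (i : Fin n → Bool) (d : Pauli) (y : (Fin n → Bool) → V.Out)
    (a : (Fin n → Bool) → Pauli) : ℝ :=
  ∑ v, Real.sqrt (V.lik n y a i v * V.lik n y a i (v + d))

theorem sqrtSum_cons_false (n : ℕ) (i : Fin n → Bool) (d : Pauli)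
    (y : (Fin (n + 1) → Bool) → V.Out) (a : (Fin (n + 1) → Bool) → Pauli) :
    V.sqrtSum (n + 1) (Fin.cons false i) d y a = 4 ^ 2 ^ n *
      V.bad.sqrtSum n i d (fun k => V.badOut (y (Fin.cons false k), y (Fin.cons true k)))
        (fun t => a (Fin.cons false t)) := by
  simp only [sqrtSum, lik_cons_false, Finset.mul_sum]
  exact Finset.sum_congr rfl fun v _ => sqrt_mul_mul_mul (by positivity)

theorem sqrtSum_cons_true (n : ℕ) (i : Fin n → Bool) (d : Pauli)
    (y : (Fin (n + 1) → Bool) → V.Out) (a : (Fin (n + 1) → Bool) → Pauli) :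
    V.sqrtSum (n + 1) (Fin.cons true i) d y a = 4 ^ 2 ^ n *
      V.good.sqrtSum n i d (fun k => V.goodOut (polarTransform n (fun t => a (Fin.cons false t)) k,
        (y (Fin.cons false k), y (Fin.cons true k)))) (fun t => a (Fin.cons true t)) := by
  simp only [sqrtSum, lik_cons_true, Finset.mul_sum]
  exact Finset.sum_congr rfl fun v _ => sqrt_mul_mul_mul (by positivity)

theorem sum_arrow_badOut {n : ℕ} (f : ((Fin n → Bool) → V.bad.Out) → ℝ) :
    ∑ y, f y = ∑ p : (Fin n → Bool) → V.Out, ∑ q : (Fin n → Bool) → V.Out,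
      f fun k => V.badOut (p k, q k) :=
  sum_arrow_prod (A := V.Out) (B := V.Out) f

theorem sum_arrow_goodOut {n : ℕ} (f : ((Fin n → Bool) → V.good.Out) → ℝ) :
    ∑ y, f y = ∑ a : (Fin n → Bool) → Pauli, ∑ p : (Fin n → Bool) → V.Out,
      ∑ q : (Fin n → Bool) → V.Out, f fun k => V.goodOut (polarTransform n a k, (p k, q k)) := by
  refine (sum_arrow_prod (A := Pauli) (B := V.Out × V.Out) f).trans ?_
  rw [← Equiv.sum_comp (polarPerm n)]
  refine Finset.sum_congr rfl fun a _ => ?_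
  exact sum_arrow_prod (A := V.Out) (B := V.Out)
    fun y : (Fin n → Bool) → V.Out × V.Out => f fun k => V.goodOut (polarTransform n a k, y k)

/-- The Bhattacharyya parameters of the virtual channel at position `i`, in terms of the
likelihoods: the first bit of `i` turns likelihoods for `V` into likelihoods for a step
of `V`. -/
theorem sum_sqrtSum (n : ℕ) (i : Fin n → Bool) (d : Pauli) :
    ∑ y, ∑ a, V.sqrtSum n i d y a = extCount n i * 4 ^ 2 ^ n * (V.virt i).bhat d := by
  induction n generalizing V with
  | zero =>
    have hl : ∀ y a v, V.lik 0 y a i v = V.prob (y i) v := by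
      intro y a v
      have hp : ∀ e, V.pathProb 0 y e = V.prob (y i) (e i) := fun e => by
        unfold pathProb
        exact Fintype.prod_subsingleton _ i
      have he : ∀ e : (Fin 0 → Bool) → Pauli, e i = v ↔ e = fun _ => v := fun e =>
        ⟨fun h => funext fun j => by rw [Subsingleton.elim j i, h], fun h => by rw [h]⟩
      simp only [lik, ind_true (agrees_zero i _ a), one_mul, he, sum_ind_mul, hp]
    have hy : ∀ f : V.Out → ℝ, ∑ y : (Fin 0 → Bool) → V.Out, f (y i) = ∑ y, f y := fun f =>
      Fintype.sum_equiv (Equiv.funUnique (Fin 0 → Bool) V.Out) _ _ fun y =>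
        congrArg f (congrArg y (Subsingleton.elim _ _))
    have hv : V.virt i = V := by simp [virt]
    have hcard : Fintype.card ((Fin 0 → Bool) → Pauli) = 4 := by simp
    simp only [sqrtSum, hl, Finset.sum_const, Finset.card_univ, hcard, nsmul_eq_mul]
    rw [hy fun y => ((4 : ℕ) : ℝ) * ∑ v, Real.sqrt (V.prob y v * V.prob y (v + d)),
      ← Finset.mul_sum, Finset.sum_comm, extCount_zero, hv, bhat]
    simp only [bhatPair]
    push_cast
    ring
  | succ n ih =>
    obtain ⟨b, i, rfl⟩ : ∃ b i', i = Fin.cons b i' :=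
      ⟨i 0, Fin.tail i, (Fin.cons_self_tail i).symm⟩
    have hcard : (Fintype.card ((Fin n → Bool) → Pauli) : ℝ) = 4 ^ 2 ^ n := by simp
    have hpow : (4 : ℝ) ^ 2 ^ (n + 1) = 4 ^ 2 ^ n * 4 ^ 2 ^ n := by
      rw [← pow_add]; ring_nf
    rw [virt_cons, hpow]
    cases b with
    | false =>
      have hI := ih V.bad i
      rw [sum_arrow_badOut] at hI
      simp only [sqrtSum_cons_false, sum_split, splitEquiv_symm_false, splitEquiv_symm_true,
        Finset.sum_const, Finset.card_univ, nsmul_eq_mul, hcard, ← Finset.mul_sum]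
      rw [extCount_cons_false, step_false, hI]
      ring
    | true =>
      have hI := ih V.good i
      rw [sum_arrow_goodOut] at hI
      simp only [sqrtSum_cons_true, sum_split, splitEquiv_symm_false, splitEquiv_symm_true,
        ← Finset.mul_sum]
      rw [extCount_cons_true, step_true]
      have hcomm : ∀ F : ((Fin n → Bool) → V.Out) → ((Fin n → Bool) → V.Out) →
          ((Fin n → Bool) → Pauli) → ℝ, ∑ p, ∑ q, ∑ a, F p q a = ∑ a, ∑ p, ∑ q, F p q a := by
        intro F
        rw [Finset.sum_comm]
        simp only [Finset.sum_comm (s := (Finset.univ : Finset ((Fin n → Bool) → V.Out)))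
          (t := (Finset.univ : Finset ((Fin n → Bool) → Pauli)))]
        refine Finset.sum_congr rfl fun a _ => ?_
        exact Finset.sum_comm
      rw [hcomm, hI]
      ring

/-- Averaging over the error at the inputs of the circuit, when the event `g` depends only on
the values before and at `i`. -/
theorem extCount_mul_sum (n : ℕ) (i : Fin n → Bool) (y : (Fin n → Bool) → V.Out)
    (g : ((Fin n → Bool) → Pauli) → Pauli → ℝ)
    (hg : ∀ e a, Agrees i e a → g e = g a) :
    extCount n i * ∑ e, V.pathProb n y e * g e (e i) = ∑ a, ∑ v, V.lik n y a i v * g a v := by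
  simp only [lik, Finset.sum_mul]
  have h : ∀ a, ∑ v, ∑ e, ind (Agrees i e a) * (ind (e i = v) * V.pathProb n y e) * g a v =
      ∑ e, ind (Agrees i e a) * (V.pathProb n y e * g e (e i)) := by
    intro a
    rw [Finset.sum_comm]
    refine Finset.sum_congr rfl fun e _ => ?_
    by_cases hc : Agrees i e a
    · rw [hg e a hc]
      have h2 : ∀ v, ind (Agrees i e a) * (ind (e i = v) * V.pathProb n y e) * g a v =
          ind (v = e i) * (ind (Agrees i e a) * (V.pathProb n y e * g a v)) := fun v => by
        rw [eq_comm (a := v)]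
        ring
      simp only [h2, sum_ind_mul]
    · simp [ind_false hc]
  simp only [h]
  rw [Finset.sum_comm, Finset.mul_sum]
  refine Finset.sum_congr rfl fun e _ => ?_
  rw [← Finset.sum_mul, sum_agrees]

end Chan

/-! ### The successive cancellation decoder -/

variable {X : Type u} [Fintype X] (N : CMPChannel X)

theorem counterpart_prob_zero (x : X) (u v : Pauli) :
    N.counterpart.prob (x, u) v = N.counterpart.prob (x, 0) (v + u) := by
  change N.weight x * N.err x (u + v) = N.weight x * N.err x (0 + (v + u))
  rw [zero_add, add_comm]

theorem likelihood_eq_lik (n : ℕ) (x : (Fin n → Bool) → X) (a : (Fin n → Bool) → Pauli)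
    (i : Fin n → Bool) : likelihood N n x a i = N.counterpart.lik n (fun k => (x k, 0)) a i := by
  funext v
  unfold likelihood Chan.lik
  refine Finset.sum_congr rfl fun e _ => ?_
  rw [← mul_assoc, ← ind_and]
  unfold ind Agrees Chan.pathProb
  split_ifs <;> simp

/-- The symmetry of the classical counterpart: an observed Pauli error `u` is a shift of the
input. -/
theorem lik_counterpart (n : ℕ) (x : (Fin n → Bool) → X) (w a : (Fin n → Bool) → Pauli)
    (i : Fin n → Bool) (v : Pauli) :
    N.counterpart.lik n (fun k => (x k, polarTransform n w k)) a i v =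
      N.counterpart.lik n (fun k => (x k, 0)) (a + w) i (v + w i) := by
  unfold Chan.lik
  rw [← Equiv.sum_comp (Equiv.addRight w)
    (fun e => ind (Agrees i e (a + w)) * (ind (e i = v + w i) *
      N.counterpart.pathProb n (fun k => (x k, 0)) e))]
  refine Finset.sum_congr rfl fun e _ => ?_
  have h1 : Agrees i (e + w) (a + w) ↔ Agrees i e a :=
    forall_congr' fun j => imp_congr_right fun _ => by simp
  have h2 : (e + w) i = v + w i ↔ e i = v := by simp
  have h3 : N.counterpart.pathProb n (fun k => (x k, polarTransform n w k)) e =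
      N.counterpart.pathProb n (fun k => (x k, 0)) (e + w) := by
    unfold Chan.pathProb
    refine Finset.prod_congr rfl fun k _ => ?_
    rw [counterpart_prob_zero, polarTransform_add]
    rfl
  simp only [Equiv.coe_addRight, h1, h2, h3]

/-- For the observation `I ⋯ I`, the likelihoods have the Bhattacharyya parameters of the virtual
channel. -/
theorem sum_sqrtSum_counterpart (n : ℕ) (i : Fin n → Bool) (d : Pauli) :
    ∑ x : (Fin n → Bool) → X, ∑ a, N.counterpart.sqrtSum n i d (fun k => (x k, 0)) a =
      extCount n i * (N.counterpart.virt i).bhat d := by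
  have h := N.counterpart.sum_sqrtSum n i d
  have h1 : ∀ f : ((Fin n → Bool) → N.counterpart.Out) → ℝ,
      ∑ y, f y = ∑ x : (Fin n → Bool) → X, ∑ w, f fun k => (x k, polarTransform n w k) := by
    intro f
    refine (sum_arrow_prod (A := X) (B := Pauli) f).trans (Finset.sum_congr rfl fun x _ => ?_)
    exact (Equiv.sum_comp (polarPerm n)
      (fun u : (Fin n → Bool) → Pauli => f fun k => (x k, u k))).symm
  have h2 : ∀ (x : (Fin n → Bool) → X) (w : (Fin n → Bool) → Pauli),
      ∑ a, N.counterpart.sqrtSum n i d (fun k => (x k, polarTransform n w k)) a =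
        ∑ a, N.counterpart.sqrtSum n i d (fun k => (x k, 0)) a := by
    intro x w
    rw [← Equiv.sum_comp (Equiv.addRight w)
      (fun a => N.counterpart.sqrtSum n i d (fun k => (x k, 0)) a)]
    refine Finset.sum_congr rfl fun a _ => ?_
    unfold Chan.sqrtSum
    rw [← Equiv.sum_comp (Equiv.addRight (w i))
      (fun v => Real.sqrt (N.counterpart.lik n (fun k => (x k, 0)) (Equiv.addRight w a) i v *
        N.counterpart.lik n (fun k => (x k, 0)) (Equiv.addRight w a) i (v + d)))]
    refine Finset.sum_congr rfl fun v _ => ?_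
    simp only [lik_counterpart, Equiv.coe_addRight, add_right_comm v (w i) d]
  rw [h1] at h
  simp only [h2, Finset.sum_const, Finset.card_univ, nsmul_eq_mul, ← Finset.mul_sum] at h
  have hcard : (Fintype.card ((Fin n → Bool) → Pauli) : ℝ) = 4 ^ 2 ^ n := by simp
  rw [hcard, mul_comm (extCount n i), mul_assoc] at h
  exact mul_left_cancel₀ (by positivity) h

/-- The differences `d` between the error and a wrong decision at a position with role `c`. For a
half-noisy position, the partial channel also compares with inputs whose known bit differs. -/
def Role.confusable : Role → Finset Pauli
  | .info => {(0, 1), (1, 0), (1, 1)}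
  | .plus => {(1, 0), (1, 1)}
  | .zero => {(0, 1), (1, 1)}
  | .epr => ∅

theorem le_sqrt_mul {s t : ℝ} (hs : 0 ≤ s) (h : s ≤ t) : s ≤ Real.sqrt (s * t) :=
  Real.le_sqrt_of_sq_le (by nlinarith)

theorem le_sqrt_mul_add {s t t' : ℝ} (hs : 0 ≤ s) (ht : 0 ≤ t) (ht' : 0 ≤ t')
    (h : s ≤ t + t') : s ≤ Real.sqrt (s * t) + Real.sqrt (s * t') := by
  refine (le_sqrt_mul hs h).trans ?_
  have := sqrt_sum_le (Finset.univ : Finset Bool)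
    (fun b => if b then s * t else s * t') (fun b => by split_ifs <;> positivity)
  simpa [mul_add] using this

/-- If a wrong decision is possible for the error `v`, then the likelihood of `v` is at most the
sum of its geometric means with the likelihoods of other errors. -/
theorem le_sum_sqrt_of_decides {r : HalfRule} {l : Pauli → ℝ} (hl : ∀ v, 0 ≤ l v) {c : Role}
    {v w : Pauli} (hw : w ≠ v) (h : Decides r l (c.reveal v) w c) :
    l v ≤ ∑ d ∈ c.confusable, Real.sqrt (l v * l (v + d)) := by
  have hbit : ∀ {a b : ZMod 2}, a ≠ b → a = b + 1 := by decide
  obtain ⟨a, b⟩ := v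
  obtain ⟨a', b'⟩ := w
  have h2 : ∀ b : ZMod 2, l (a + 1, 0) + l (a + 1, 1) = l (a + 1, b) + l (a + 1, b + 1) := by
    intro b
    rcases (show ∀ b : ZMod 2, b = 0 ∨ b = 1 by decide) b with rfl | rfl
    · rw [zero_add]
    · rw [show (1 : ZMod 2) + 1 = 0 by decide, add_comm]
  have h3 : ∀ a : ZMod 2, l (0, b + 1) + l (1, b + 1) = l (a, b + 1) + l (a + 1, b + 1) := by
    intro a
    rcases (show ∀ b : ZMod 2, b = 0 ∨ b = 1 by decide) a with rfl | rfl
    · rw [zero_add]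
    · rw [show (1 : ZMod 2) + 1 = 0 by decide, add_comm]
  cases c with
  | info =>
    obtain ⟨d, hd, hdw⟩ : ∃ d ∈ Role.info.confusable, (a', b') = ((a, b) : Pauli) + d :=
      (show ∀ v w : Pauli, w ≠ v →
        ∃ d ∈ ({(0, 1), (1, 0), (1, 1)} : Finset Pauli), w = v + d by decide) _ _ hw
    have h1 := h (a, b)
    rw [hdw] at h1
    exact (le_sqrt_mul (hl _) h1).trans (Finset.single_le_sum
      (f := fun d => Real.sqrt (l (a, b) * l ((a, b) + d)))
      (fun _ _ => Real.sqrt_nonneg _) hd)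
  | plus =>
    obtain ⟨rfl, hmax⟩ : b' = b ∧ ∀ k, r.first l b k ≤ r.first l b a' := h
    have ha : a' = a + 1 := hbit fun hcon => hw (by rw [hcon])
    have hm := hmax a
    rw [ha] at hm
    rw [Role.confusable, Finset.sum_pair (by decide)]
    simp only [Prod.mk_add_mk, add_zero]
    cases r with
    | conditional =>
      exact (le_sqrt_mul (hl _) hm).trans (le_add_of_nonneg_right (Real.sqrt_nonneg _))
    | partialChannel =>
      refine le_sqrt_mul_add (hl _) (hl _) (hl _) (le_trans ?_ (hm.trans_eq (h2 b')))
      rcases (show ∀ b : ZMod 2, b = 0 ∨ b = 1 by decide) b' with hb | hb <;> rw [hb]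
      · exact le_add_of_nonneg_right (hl _)
      · exact le_add_of_nonneg_left (hl _)
  | zero =>
    obtain ⟨rfl, hmax⟩ : a' = a ∧ ∀ k, r.second l a k ≤ r.second l a b' := h
    have hb : b' = b + 1 := hbit fun hcon => hw (by rw [hcon])
    have hm := hmax b
    rw [hb] at hm
    rw [Role.confusable, Finset.sum_pair (by decide)]
    simp only [Prod.mk_add_mk, add_zero]
    cases r with
    | conditional =>
      exact (le_sqrt_mul (hl _) hm).trans (le_add_of_nonneg_right (Real.sqrt_nonneg _))
    | partialChannel =>
      refine le_sqrt_mul_add (hl _) (hl _) (hl _) (le_trans ?_ (hm.trans_eq (h3 a')))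
      rcases (show ∀ b : ZMod 2, b = 0 ∨ b = 1 by decide) a' with ha | ha <;> rw [ha]
      · exact le_add_of_nonneg_right (hl _)
      · exact le_add_of_nonneg_left (hl _)
  | epr => exact absurd h hw

theorem sum_bhat_confusable_le (δ : ℝ) (hδ : 0 ≤ δ) (n : ℕ) (i : Fin n → Bool) :
    ∑ d ∈ (role N δ n i).confusable, (N.counterpart.virt i).bhat d ≤ 3 * δ := by
  unfold role
  split_ifs with h1 h2 h3
  · obtain ⟨ha, hb, hc⟩ := h1
    rw [Role.confusable, Finset.sum_insert (by decide), Finset.sum_pair (by decide)]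
    linarith
  · obtain ⟨ha, hb, -⟩ := h2
    rw [Role.confusable, Finset.sum_pair (by decide)]
    linarith
  · obtain ⟨ha, hb, -⟩ := h3
    rw [Role.confusable, Finset.sum_pair (by decide)]
    linarith
  · rw [Role.confusable, Finset.sum_empty]
    linarith

/-- With correct decisions before `i`, the decoder may decide wrongly at `i`, where the error
is `v`. -/
def MayErr (δ : ℝ) (n : ℕ) (r : HalfRule) (i : Fin n → Bool) (x : (Fin n → Bool) → X)
    (a : (Fin n → Bool) → Pauli) (v : Pauli) : Prop :=
  ∃ w, w ≠ v ∧ Decides r (likelihood N n x a i) ((role N δ n i).reveal v) w (role N δ n i)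

/-- The probability of a wrong decision at position `i` after correct ones. -/
theorem sum_mayErr_le (δ : ℝ) (hδ : 0 ≤ δ) (n : ℕ) (r : HalfRule) (i : Fin n → Bool) :
    ∑ x : (Fin n → Bool) → X, ∑ e, N.counterpart.pathProb n (fun k => (x k, 0)) e *
      ind (MayErr N δ n r i x e (e i)) ≤ 3 * δ := by
  refine le_of_mul_le_mul_left ?_ (extCount_pos n i)
  rw [Finset.mul_sum]
  have h1 : ∀ x : (Fin n → Bool) → X,
      extCount n i * ∑ e, N.counterpart.pathProb n (fun k => (x k, 0)) e *
        ind (MayErr N δ n r i x e (e i)) ≤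
      ∑ d ∈ (role N δ n i).confusable, ∑ a,
        N.counterpart.sqrtSum n i d (fun k => (x k, 0)) a := by
    intro x
    rw [N.counterpart.extCount_mul_sum n i (fun k => (x k, 0))
      (fun a v => ind (MayErr N δ n r i x a v)) (fun e a h => by
        simp only [MayErr, likelihood_eq_lik, N.counterpart.lik_congr _ h]), Finset.sum_comm]
    rw [Finset.sum_comm]
    rw [Finset.sum_comm (s := (role N δ n i).confusable)]
    refine Finset.sum_le_sum fun a _ => ?_
    simp only [Chan.sqrtSum]
    rw [Finset.sum_comm]
    refine Finset.sum_le_sum fun v _ => ?_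
    by_cases h : MayErr N δ n r i x a v
    · rw [ind_true h, mul_one]
      obtain ⟨w, hw, hdec⟩ := h
      rw [likelihood_eq_lik] at hdec
      exact le_sum_sqrt_of_decides (fun v => N.counterpart.lik_nonneg n _ a i v) hw hdec
    · rw [ind_false h, mul_zero]
      exact Finset.sum_nonneg fun _ _ => Real.sqrt_nonneg _
  refine (Finset.sum_le_sum fun x _ => h1 x).trans ?_
  rw [Finset.sum_comm]
  simp only [sum_sqrtSum_counterpart]
  rw [← Finset.mul_sum]
  exact mul_le_mul_of_nonneg_left (sum_bhat_confusable_le N δ hδ n i) (extCount_pos n i).le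

/-- The union bound over the position of the first wrong decision. -/
theorem blockErrorProb_le (δ : ℝ) (hδ : 0 ≤ δ) (n : ℕ) (r : HalfRule)
    (dec : ((Fin n → Bool) → X) → ((Fin n → Bool) → Pauli) → ((Fin n → Bool) → Pauli))
    (hdec : IsSCDecoder N δ n r dec) : blockErrorProb N δ n dec ≤ 2 ^ n * (3 * δ) := by
  have hfirst : ∀ (x : (Fin n → Bool) → X) (e : (Fin n → Bool) → Pauli),
      dec x (syndrome N δ n e) ≠ e → ∃ i, MayErr N δ n r i x e (e i) := by
    intro x e hne
    have hwf : WellFounded (fun j i : Fin n → Bool => toLex j < toLex i) :=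
      InvImage.wf toLex wellFounded_lt
    -- the position of the first wrong decision
    obtain ⟨i, hi, hmin⟩ := hwf.has_min {i | dec x (syndrome N δ n e) i ≠ e i}
      (Function.ne_iff.1 hne)
    refine ⟨i, dec x (syndrome N δ n e) i, hi, ?_⟩
    have hag : Agrees i (dec x (syndrome N δ n e)) e := fun j hj => by
      by_contra hcon
      exact hmin j hcon hj
    have h := hdec x (syndrome N δ n e) i
    rw [likelihood_eq_lik, N.counterpart.lik_congr _ hag, ← likelihood_eq_lik] at h
    exact h
  have hbound : blockErrorProb N δ n dec ≤ ∑ x : (Fin n → Bool) → X, ∑ e, ∑ i,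
      N.counterpart.pathProb n (fun k => (x k, 0)) e * ind (MayErr N δ n r i x e (e i)) := by
    unfold blockErrorProb
    refine Finset.sum_le_sum fun x _ => ?_
    rw [← Equiv.sum_comp (polarPerm n)]
    refine Finset.sum_le_sum fun e _ => ?_
    have hp : ∏ k, N.counterpart.prob (x k, polarPerm n e k) 0 =
        N.counterpart.pathProb n (fun k => (x k, 0)) e := by
      unfold Chan.pathProb
      refine Finset.prod_congr rfl fun k _ => ?_
      rw [counterpart_prob_zero, zero_add]
      rfl
    have hnn := N.counterpart.pathProb_nonneg n (fun k => (x k, 0)) e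
    rw [Equiv.symm_apply_apply, hp, ← Finset.mul_sum]
    split_ifs with hne
    · obtain ⟨i, hi⟩ := hfirst x e hne
      refine le_mul_of_one_le_right hnn ?_
      rw [← ind_true hi]
      exact Finset.single_le_sum (f := fun i => ind (MayErr N δ n r i x e (e i)))
        (fun _ _ => ind_nonneg _) (Finset.mem_univ i)
    · exact mul_nonneg hnn (Finset.sum_nonneg fun _ _ => ind_nonneg _)
  refine hbound.trans ?_
  have hcomm : ∑ x : (Fin n → Bool) → X, ∑ e, ∑ i,
      N.counterpart.pathProb n (fun k => (x k, 0)) e * ind (MayErr N δ n r i x e (e i)) =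
      ∑ i, ∑ x : (Fin n → Bool) → X, ∑ e,
        N.counterpart.pathProb n (fun k => (x k, 0)) e * ind (MayErr N δ n r i x e (e i)) := by
    rw [Finset.sum_comm]
    simp only [Finset.sum_comm (s := (Finset.univ : Finset ((Fin n → Bool) → X)))
      (t := (Finset.univ : Finset (Fin n → Bool)))]
    rw [Finset.sum_comm]
    refine Finset.sum_congr rfl fun i _ => ?_
    rw [Finset.sum_comm]
  rw [hcomm]
  refine (Finset.sum_le_sum fun i _ => sum_mayErr_le N δ hδ n r i).trans ?_
  simp

/-! ### The thresholds -/

open Classical in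
/-- If both parameters of each index are small, then one of the four regimes holds. -/
theorem one_sub_le_ncard_polarizedSet {δ ε : ℝ} (h : ε < δ) (n : ℕ) :
    1 - ∑ j : Bool, Chan.pathAvg n
      (fun V => if V.zMax j ≤ ε ∨ V.tvAxis j ≤ ε then (0 : ℝ) else 1) N.counterpart ≤
      ((polarizedSet N δ n).ncard : ℝ) / 2 ^ n := by
  have hmem : ∀ i : Fin n → Bool,
      (∀ j, (N.counterpart.virt i).zMax j ≤ ε ∨ (N.counterpart.virt i).tvAxis j ≤ ε) →
        i ∈ polarizedSet N δ n := by
    intro i hi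
    set V := N.counterpart.virt i with hV
    have z1 := V.one_sub_bhat_le_tv (0, 1)
    have z2 := V.one_sub_bhat_le_tv (1, 0)
    have hf := hi false
    have ht := hi true
    simp only [Chan.zMax, Chan.tvAxis, if_true, if_false, Bool.false_eq_true, max_le_iff] at hf ht
    rcases hf with ⟨hf, hf'⟩ | hf <;> rcases ht with ⟨ht, ht'⟩ | ht
    · exact Or.inl ⟨by linarith, by linarith, by linarith⟩
    · exact Or.inr (Or.inr (Or.inl ⟨by linarith, by linarith, by linarith⟩))
    · exact Or.inr (Or.inl ⟨by linarith, by linarith, by linarith⟩)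
    · exact Or.inr (Or.inr (Or.inr ⟨by linarith, by linarith⟩))
  have hcard : ((polarizedSet N δ n).ncard : ℝ) =
      ∑ i : Fin n → Bool, if i ∈ polarizedSet N δ n then (1 : ℝ) else 0 := by
    rw [Set.ncard_eq_toFinset_card', Finset.sum_boole]
    congr 2
    ext i
    simp
  rw [le_div_iff₀ (by positivity), hcard, sub_mul, one_mul, Finset.sum_mul]
  simp only [mul_comm _ ((2 : ℝ) ^ n), ← Chan.sum_virt]
  have hone : (2 : ℝ) ^ n = ∑ _i : Fin n → Bool, (1 : ℝ) := by simp
  rw [hone, Finset.sum_comm, ← Finset.sum_sub_distrib]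
  refine Finset.sum_le_sum fun i _ => ?_
  rw [Fintype.sum_bool]
  by_cases hi : ∀ j, (N.counterpart.virt i).zMax j ≤ ε ∨ (N.counterpart.virt i).tvAxis j ≤ ε
  · rw [if_pos (hmem i hi), if_pos (hi true), if_pos (hi false)]
    norm_num
  · obtain ⟨j, hj⟩ := not_forall.1 hi
    have h0 : (0 : ℝ) ≤ if i ∈ polarizedSet N δ n then (1 : ℝ) else 0 := by
      split_ifs <;> norm_num
    have hnn : ∀ k, (0 : ℝ) ≤ if (N.counterpart.virt i).zMax k ≤ ε ∨
        (N.counterpart.virt i).tvAxis k ≤ ε then (0 : ℝ) else 1 := fun k => by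
      split_ifs <;> norm_num
    have := hnn true
    have := hnn false
    cases j <;> rw [if_neg hj] <;> linarith

/-- A double sequence whose rows converge converges along a slowly growing choice of rows. -/
theorem exists_diagonal {F : ℕ → ℕ → ℝ} {l : ℝ}
    (h : ∀ j, Filter.Tendsto (F j) Filter.atTop (𝓝 l)) :
    ∃ k : ℕ → ℕ, Filter.Tendsto k Filter.atTop Filter.atTop ∧
      Filter.Tendsto (fun n => F (k n) n) Filter.atTop (𝓝 l) := by
  classical
  let P : ℕ → ℕ → Prop := fun n j => |F j n - l| ≤ 1 / ((j : ℝ) + 1)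
  have hP : ∀ j, ∀ᶠ n in Filter.atTop, P n j := by
    intro j
    have h1 : (0 : ℝ) < 1 / ((j : ℝ) + 1) := by positivity
    filter_upwards [(h j).eventually (Metric.closedBall_mem_nhds l h1)] with n hn
    exact hn
  have hk : ∀ j, ∀ᶠ n in Filter.atTop, j ≤ Nat.findGreatest (P n) n ∧
      P n (Nat.findGreatest (P n) n) := by
    intro j
    filter_upwards [hP j, Filter.eventually_ge_atTop j] with n hn hjn
    exact ⟨Nat.le_findGreatest hjn hn, Nat.findGreatest_spec hjn hn⟩
  refine ⟨fun n => Nat.findGreatest (P n) n,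
    Filter.tendsto_atTop.2 fun j => (hk j).mono fun n hn => hn.1, ?_⟩
  rw [Metric.tendsto_atTop]
  intro η hη
  obtain ⟨j, hj⟩ := exists_nat_one_div_lt hη
  obtain ⟨M, hM⟩ := Filter.eventually_atTop.1 (hk j)
  refine ⟨M, fun n hn => ?_⟩
  obtain ⟨h1, h2⟩ := hM n hn
  rw [Real.dist_eq]
  refine lt_of_le_of_lt (h2.trans ?_) hj
  exact one_div_le_one_div_of_le (by positivity) (by exact_mod_cast Nat.succ_le_succ h1)

end
end QPolar

theorem mainTheorem3 {X : Type*} [Fintype X] (N : QPolar.CMPChannel X) :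
    ∃ δ : ℕ → ℝ, (∀ n, 0 < δ n ∧ δ n < 1 / 2) ∧
      Filter.Tendsto δ Filter.atTop (𝓝 0) ∧
      Filter.Tendsto (fun n : ℕ => ((QPolar.polarizedSet N (δ n) n).ncard : ℝ) / 2 ^ n)
        Filter.atTop (𝓝 1) ∧
      ∀ (r : QPolar.HalfRule)
        (dec : ∀ n : ℕ, ((Fin n → Bool) → X) → ((Fin n → Bool) → QPolar.Pauli) →
          ((Fin n → Bool) → QPolar.Pauli)),
        (∀ n, QPolar.IsSCDecoder N (δ n) n r (dec n)) →
        ∀ β : ℝ, 0 < β → β < 1 / 4 →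
          (fun n : ℕ => QPolar.blockErrorProb N (δ n) n (dec n)) =O[Filter.atTop]
            (fun n : ℕ => (2 : ℝ) ^ n * (2 : ℝ) ^ (-((2 : ℝ) ^ (β * (n : ℝ))))) := by
  -- exponents `γ j < 1 / 4` that tend to `1 / 4`, and the threshold belonging to an exponent
  set γ : ℕ → ℝ := fun j => 1 / 4 - 1 / 8 * (1 / ((j : ℝ) + 1)) with hγ
  have hγ0 : ∀ j, 0 < γ j := fun j => by
    have : 1 / ((j : ℝ) + 1) ≤ 1 := by
      rw [div_le_one (by positivity)]
      linarith [(Nat.cast_nonneg j : (0 : ℝ) ≤ j)]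
    simp only [hγ]
    linarith
  have hγ1 : ∀ j, γ j < 1 / 4 := fun j => by
    have : 0 < 1 / ((j : ℝ) + 1) := by positivity
    simp only [hγ]
    linarith
  have hγlim : Filter.Tendsto γ Filter.atTop (𝓝 (1 / 4)) := by
    have h := ((tendsto_one_div_add_atTop_nhds_zero_nat (𝕜 := ℝ)).const_mul
      (1 / 8)).const_sub (1 / 4 : ℝ)
    rwa [mul_zero, sub_zero] at h
  set δ' : ℝ → ℕ → ℝ := fun β n => (2 : ℝ) ^ (-(1 + (2 : ℝ) ^ (β * (n : ℝ)))) with hδ'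
  have hδ'0 : ∀ β n, 0 < δ' β n := fun β n => by positivity
  have hδ'1 : ∀ β n, δ' β n < 1 / 2 := fun β n => by
    have h1 : (1 / 2 : ℝ) = (2 : ℝ) ^ (-1 : ℝ) := by rw [Real.rpow_neg_one]; norm_num
    rw [h1]
    refine Real.rpow_lt_rpow_of_exponent_lt (by norm_num) ?_
    have : 0 < (2 : ℝ) ^ (β * (n : ℝ)) := by positivity
    linarith
  have hfrac : ∀ j, Filter.Tendsto (fun n : ℕ =>
      ((QPolar.polarizedSet N (δ' (γ j) n) n).ncard : ℝ) / 2 ^ n) Filter.atTop (𝓝 1) := by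
    intro j
    have hsum := (tendsto_finsetSum Finset.univ fun (b : Bool) _ =>
      N.counterpart.tendsto_pathAvg_fast (hγ0 j) (hγ1 j) b).const_sub 1
    simp only [Finset.sum_const_zero, sub_zero] at hsum
    refine tendsto_of_tendsto_of_tendsto_of_le_of_le hsum tendsto_const_nhds
      (fun n => QPolar.one_sub_le_ncard_polarizedSet N ?_ n) (fun n => ?_)
    · exact Real.rpow_lt_rpow_of_exponent_lt (by norm_num) (by linarith)
    · beta_reduce
      rw [div_le_one (by positivity)]
      have h := Set.ncard_le_card (QPolar.polarizedSet N (δ' (γ j) n) n)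
      rw [Nat.card_eq_fintype_card] at h
      simp only [Fintype.card_pi, Fintype.card_bool, Finset.prod_const, Finset.card_univ,
        Fintype.card_fin] at h
      exact_mod_cast h
  obtain ⟨k, hk, hklim⟩ := QPolar.exists_diagonal hfrac
  -- the thresholds decay at every rate `β < 1 / 4`
  have hfast : ∀ β : ℝ, β < 1 / 4 → ∀ᶠ n : ℕ in Filter.atTop,
      δ' (γ (k n)) n ≤ (2 : ℝ) ^ (-((2 : ℝ) ^ (β * (n : ℝ)))) := by
    intro β hβ
    filter_upwards [(hγlim.comp hk).eventually_const_lt hβ] with n hn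
    refine Real.rpow_le_rpow_of_exponent_le (by norm_num) ?_
    have h1 : (2 : ℝ) ^ (β * (n : ℝ)) ≤ (2 : ℝ) ^ (γ (k n) * (n : ℝ)) :=
      Real.rpow_le_rpow_of_exponent_le (by norm_num)
        (mul_le_mul_of_nonneg_right hn.le (Nat.cast_nonneg n))
    linarith
  refine ⟨fun n => δ' (γ (k n)) n, fun n => ⟨hδ'0 _ _, hδ'1 _ _⟩, ?_, hklim, ?_⟩
  · have hlim : Filter.Tendsto (fun n : ℕ => (2 : ℝ) ^ (-((2 : ℝ) ^ (1 / 8 * (n : ℝ)))))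
        Filter.atTop (𝓝 0) := by
      have h1 : Filter.Tendsto (fun n : ℕ => 1 / 8 * (n : ℝ)) Filter.atTop Filter.atTop :=
        tendsto_natCast_atTop_atTop.const_mul_atTop (by norm_num)
      have h2 := (tendsto_rpow_atTop_of_base_gt_one 2 (by norm_num)).comp h1
      have h3 := (tendsto_rpow_atTop_of_base_gt_one 2 (by norm_num)).comp h2
      refine (tendsto_inv_atTop_zero.comp h3).congr fun n => ?_
      simp only [Function.comp]
      rw [Real.rpow_neg (by norm_num)]
    refine squeeze_zero' (Filter.Eventually.of_forall fun n => (hδ'0 _ _).le)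
      (hfast (1 / 8) (by norm_num)) hlim
  · intro r dec hdec β _ hβ
    refine Asymptotics.IsBigO.of_bound 3 ?_
    filter_upwards [hfast β hβ] with n hn
    have h0 : 0 ≤ QPolar.blockErrorProb N (δ' (γ (k n)) n) n (dec n) := by
      unfold QPolar.blockErrorProb
      refine Finset.sum_nonneg fun x _ => Finset.sum_nonneg fun E _ => ?_
      split_ifs
      · exact Finset.prod_nonneg fun _ _ => N.counterpart.prob_nonneg _ _
      · exact le_rfl
    rw [Real.norm_of_nonneg h0, Real.norm_of_nonneg (by positivity)]
    refine (QPolar.blockErrorProb_le N _ (hδ'0 _ _).le n r (dec n) (hdec n)).trans ?_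
    have h2 : (0 : ℝ) < 2 ^ n := by positivity
    nlinarith
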